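/- Let $V$ be a finite-dimensional real inner product space with $\dim V\ge 2$, let $T>0$, and let $T((V))=\prod_{n\ge 0}V^{\otimes n}$ be the extended tensor algebra, with projections $\pi^{(n)}:T((V))\to T^{(n)}(V)=\prod_{i\le n}V^{\otimes i}$ and unit $\mathbf 1=(1,0,0,\dots)$. Let $G^{(\star)}\subset T((V))$ be the set of group-like elements, i.e. of all $g$ with constant term $1$ and $\Delta g=g\otimes g$, where $\Delta$ is the coproduct determined by multiplicativity and $\Delta v=v\otimes 1+1\otimes v$ for $v\in V$. Let $G^{(n)}=\pi^{(n)}(G^{(\star)})$ be the step-$n$ free nilpotent Lie group, equipped with the Carnot–Carathéodory metric. For real $p\ge 1$, let $C^{p\text{-var}}([0,T],G^{(n)})$ be the set of continuous paths of finite $p$-variation in $G^{(n)}$ that start at the unit; the elements of $C^{p\text{-var}}([0,T],G^{(\lfloor p\rfloor)})$ are the weakly geometric $p$-rough paths. The signature of such a path $\mathbb X$ is $\mathbb S_{0,T}(\mathbb X)\in G^{(\star)}$, where $t\mapsto \mathbb S_{0,t}(\mathbb X)$ is its Lyons lift: the unique path $[0,T]\to G^{(\star)}$ with $\mathbb S_{0,0}(\mathbb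 X)=\mathbf 1$, with $\pi^{(\lfloor p\rfloor)}(\mathbb S_{0,\cdot}(\mathbb X))=\mathbb X$, and with $\pi^{(n)}(\mathbb S_{0,\cdot}(\mathbb X))\in C^{p\text{-var}}([0,T],G^{(n)})$ for every $n$. Let $\mathscr S$ be the set of the signatures of all weakly geometric $p$-rough paths, for all real $p\ge 1$. Then $\mathscr S$ is a strict subset of $G^{(\star)}$. Moreover, if $G^{(\star)}$ carries the topology inherited from the product topology on $T((V))$, then $\mathscr S$ is a meagre subset of $G^{(\star)}$. -/

import Mathlib

namespace RoughPath

noncomputable section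

open Set Filter Topology MeasureTheory
open scoped ENNReal TensorProduct

/-- The tensor power `V^{⊗n}`, realised as the degree-`n` homogeneous part of the tensor algebra
of `V`, so that `⊗` is the multiplication of the tensor algebra. -/
abbrev TPow (V : Type*) [AddCommGroup V] [Module ℝ V] (n : ℕ) :
    Submodule ℝ (TensorAlgebra ℝ V) :=
  LinearMap.range (TensorAlgebra.ι ℝ : V →ₗ[ℝ] TensorAlgebra ℝ V) ^ n

/-- For finite-dimensional `V` the space `V^{⊗n}` is finite-dimensional, and the module topology is
its usual topology, the one defined by any norm. -/
instance TPow.instTopologicalSpace (V : Type*) [AddCommGroup V] [Module ℝ V] (n : ℕ) :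
    TopologicalSpace (TPow V n) :=
  moduleTopology ℝ (TPow V n)

/-- The extended tensor algebra `T((V)) = ∏ₙ V^{⊗n}`, with the product topology. -/
abbrev TensorSeries (V : Type*) [AddCommGroup V] [Module ℝ V] : Type _ :=
  (n : ℕ) → TPow V n

/-- The truncated tensor algebra `T^{(n)}(V) = ∏_{i ≤ n} V^{⊗i}`. -/
abbrev TruncTensor (V : Type*) [AddCommGroup V] [Module ℝ V] (n : ℕ) : Type _ :=
  (i : Fin (n + 1)) → TPow V i

/-- The projection `π^{(n)} : T((V)) → T^{(n)}(V)`. -/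
def trunc {V : Type*} [AddCommGroup V] [Module ℝ V] (n : ℕ) (g : TensorSeries V) :
    TruncTensor V n :=
  fun i => g i

/-- The unit `𝟏 = (1, 0, 0, …)` of `T((V))`. -/
def unitSeries (V : Type*) [AddCommGroup V] [Module ℝ V] : TensorSeries V
  | 0 => ⟨1, SetLike.one_mem_graded (TPow V)⟩
  | _ + 1 => 0

/-- The coproduct of the tensor algebra: the algebra homomorphism with
`Δ v = v ⊗ 1 + 1 ⊗ v` for `v ∈ V`. -/
def coproduct (V : Type*) [AddCommGroup V] [Module ℝ V] :
    TensorAlgebra ℝ V →ₐ[ℝ] TensorAlgebra ℝ V ⊗[ℝ] TensorAlgebra ℝ V :=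
  TensorAlgebra.lift ℝ
    ((Algebra.TensorProduct.includeLeft (R := ℝ) (S := ℝ) (A := TensorAlgebra ℝ V)
        (B := TensorAlgebra ℝ V)).toLinearMap ∘ₗ TensorAlgebra.ι ℝ +
      (Algebra.TensorProduct.includeRight (R := ℝ) (A := TensorAlgebra ℝ V)
        (B := TensorAlgebra ℝ V)).toLinearMap ∘ₗ TensorAlgebra.ι ℝ)

/-- The set `G^{(⋆)}` of group-like elements of `T((V))`: those `g` with constant term `1` and
`Δ g = g ⊗ g`, where the last identity is read off in every total degree `n`. -/
def groupLike (V : Type*) [AddCommGroup V] [Module ℝ V] : Set (TensorSeries V) :=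
  {g | (g 0 : TensorAlgebra ℝ V) = 1 ∧
    ∀ n : ℕ, coproduct V (g n) =
      ∑ ij ∈ Finset.HasAntidiagonal.antidiagonal n, (g ij.1 : TensorAlgebra ℝ V) ⊗ₜ[ℝ] (g ij.2 : TensorAlgebra ℝ V)}

/-- The step-`n` free nilpotent group `G^{(n)} = π^{(n)}(G^{(⋆)})`. -/
def truncGroup (V : Type*) [AddCommGroup V] [Module ℝ V] (n : ℕ) : Set (TruncTensor V n) :=
  trunc n '' groupLike V

/-- `Γ : [0,1] → T^{(n)}(V)` is a horizontal curve with control `u ∈ L¹([0,1], V)`: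
it solves `dΓ_t = Γ_t ⊗ u_t dt`, that is, `Γ_t = Γ_0 + ∫₀ᵗ Γ_s ⊗ u_s ds` in `T^{(n)}(V)`.
The integrals of functions with values in the finite-dimensional spaces `V^{⊗k}` are expressed
through all linear functionals `ℓ`. -/
structure IsHorizontal {V : Type*} [NormedAddCommGroup V] [InnerProductSpace ℝ V] (n : ℕ)
    (u : ℝ → V) (Γ : ℝ → TruncTensor V n) : Prop where
  integrable : IntegrableOn u (Icc 0 1)
  level_zero : ∀ t ∈ Icc (0 : ℝ) 1, Γ t 0 = Γ 0 0
  level_succ : ∀ (k : Fin n) (ℓ : Module.Dual ℝ (TensorAlgebra ℝ V)), ∀ t ∈ Icc (0 : ℝ) 1,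
    ℓ (Γ t k.succ) =
      ℓ (Γ 0 k.succ) +
        ∫ s in (0 : ℝ)..t, ℓ ((Γ s k.castSucc : TensorAlgebra ℝ V) * TensorAlgebra.ι ℝ (u s))

/-- The Carnot–Carathéodory distance on `G^{(n)}`: the infimum of the lengths `∫₀¹ ‖u_s‖ ds` of the
horizontal curves from `g` to `h`. -/
def ccDist {V : Type*} [NormedAddCommGroup V] [InnerProductSpace ℝ V] (n : ℕ)
    (g h : TruncTensor V n) : ℝ≥0∞ :=
  ⨅ (u : ℝ → V) (Γ : ℝ → TruncTensor V n) (_ : IsHorizontal n u Γ) (_ : Γ 0 = g) (_ : Γ 1 = h),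
    ∫⁻ s in Icc (0 : ℝ) 1, ‖u s‖ₑ

/-- The `p`-variation on `[0,T]` of a path in `G^{(n)}`, with respect to the Carnot–Carathéodory
distance; the supremum is over finite sequences `t_0 ≤ t_1 ≤ … ≤ t_m` in `[0,T]`. -/
def pVar {V : Type*} [NormedAddCommGroup V] [InnerProductSpace ℝ V] (p T : ℝ) (n : ℕ)
    (X : ℝ → TruncTensor V n) : ℝ≥0∞ :=
  (⨆ q : ℕ × {t : ℕ → ℝ // Monotone t ∧ ∀ i, t i ∈ Icc 0 T},
    ∑ i ∈ Finset.range q.1, ccDist n (X (q.2.1 i)) (X (q.2.1 (i + 1))) ^ p) ^ (1 / p)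

/-- Membership in `C^{p-var}([0,T], G^{(n)})`: paths with values in `G^{(n)}`, started at the unit,
continuous for the Carnot–Carathéodory metric and of finite `p`-variation.
Only the values of `X` on `[0,T]` matter. -/
structure IsPVarPath {V : Type*} [NormedAddCommGroup V] [InnerProductSpace ℝ V] (p T : ℝ) (n : ℕ)
    (X : ℝ → TruncTensor V n) : Prop where
  mem_group : ∀ t ∈ Icc 0 T, X t ∈ truncGroup V n
  start : X 0 = trunc n (unitSeries V)
  continuous : ∀ s ∈ Icc 0 T, Tendsto (fun t => ccDist n (X s) (X t)) (𝓝[Icc 0 T] s) (𝓝 0)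
  finite_pVar : pVar p T n X < ∞

/-- The space `WGΩ_p(V) = C^{p-var}([0,T], G^{(⌊p⌋)})` of weakly geometric rough paths. -/
def WeaklyGeometric (V : Type*) [NormedAddCommGroup V] [InnerProductSpace ℝ V] (p T : ℝ) :
    Set (ℝ → TruncTensor V ⌊p⌋₊) :=
  {X | IsPVarPath p T ⌊p⌋₊ X}

/-- `S` is the Lyons lift `t ↦ 𝕊_{0,t}(X)` of the weakly geometric `p`-rough path `X`: the path in
`G^{(⋆)}` started at the unit, of finite `p`-variation at every level, that extends `X`. -/
structure IsLyonsLift {V : Type*} [NormedAddCommGroup V] [InnerProductSpace ℝ V] (p T : ℝ)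
    (X : ℝ → TruncTensor V ⌊p⌋₊) (S : ℝ → TensorSeries V) : Prop where
  mem_groupLike : ∀ t ∈ Icc 0 T, S t ∈ groupLike V
  start : S 0 = unitSeries V
  isPVarPath : ∀ n : ℕ, IsPVarPath p T n (fun t => trunc n (S t))
  extends_path : ∀ t ∈ Icc 0 T, trunc ⌊p⌋₊ (S t) = X t

/-- The set `𝒮_p` of signatures `𝕊_{0,T}(X)` of weakly geometric `p`-rough paths `X`. -/
def signaturesOf (V : Type*) [NormedAddCommGroup V] [InnerProductSpace ℝ V] (p T : ℝ) :
    Set (TensorSeries V) :=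
  {g | ∃ X ∈ WeaklyGeometric V p T, ∃ S : ℝ → TensorSeries V, IsLyonsLift p T X S ∧ S T = g}

/-- The set `𝒮 = ⋃_{p ≥ 1} 𝒮_p` of all signatures. -/
def signatures (V : Type*) [NormedAddCommGroup V] [InnerProductSpace ℝ V] (T : ℝ) :
    Set (TensorSeries V) :=
  ⋃ (p : ℝ) (_ : 1 ≤ p), signaturesOf V p T

end

end RoughPath

/-! Fix orthonormal vectors `a`, `b` with dual functionals `α`, `β`, and look only at the
coefficients of the words `a ⋯ a b`. The claim is that signatures obey growth bounds in the degree
taken from a countable list, whereas group-like elements obey none.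

Growth of signatures. On a group-like `g` the word `a ⋯ a` with `n` letters has coefficient `x ^ n /
n!`, `x` being the level-one coordinate (`powFunctional_groupLike`). So the generating series of the
words `a ⋯ a b` satisfies a closed form of Chen's relation (`increment_chen`), with scalar
exponentials as multipliers. A horizontal curve of length `L` changes the coefficient of degree `k +
1`, suitably recentred, by at most `L ^ (k + 1)`; this bounds increments by the Carnot–Carathéodory
distance. Let `P ≥ p` be an integer and `ω` the control of the `P`-variation at level `P`. Degrees
up to `P` are then bounded directly, and higher degrees by sewing (`exists_increment_bound`): the
bound is `C ω ^ ((k + 1) / P)` with `C` depending only on `k` and `P`. The finite variation of the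
lift at higher levels is used only qualitatively, to make partition sums vanish; its size would
depend on the path and on the degree in an uncontrolled way. Rounding `ω` up to a natural number `w`
leaves countably many bounds (`exists_growth_bounds`).

Freedom of group-like elements. Multiplying by the exponential of a multiple of `[a, [a, … [a, b]]]`
moves one coefficient arbitrarily and fixes all lower degrees (`exists_groupLike_large`). Hence each
bound defines a closed set with empty interior, which gives meagreness; iterating the perturbation
yields a group-like element that violates all the bounds, which gives strictness. -/

namespace RoughPath

noncomputable section

open Set Filter Topology MeasureTheory
open scoped ENNReal TensorProduct

/-! ### Word functionals on the tensor algebra -/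

section Algebra

/-- The degree-`n` part of `exp x * exp y = exp (x + y)`. -/
theorem sum_antidiagonal_pow_div_factorial (x y : ℝ) (n : ℕ) :
    ∑ ij ∈ Finset.HasAntidiagonal.antidiagonal n,
      x ^ ij.1 / ij.1.factorial * (y ^ ij.2 / ij.2.factorial) = (x + y) ^ n / n.factorial := by
  rw [(Commute.all x y).add_pow' n, Finset.sum_div]
  refine Finset.sum_congr rfl fun ij hij => ?_
  obtain rfl : ij.1 + ij.2 = n := Finset.HasAntidiagonal.mem_antidiagonal.1 hij
  rw [nsmul_eq_mul, Nat.cast_add_choose]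
  field_simp

variable {V : Type*} [AddCommGroup V] [Module ℝ V]

/-- The representation of the tensor algebra by `2 × 2` matrices given by
`v ↦ !![α v, β v; 0, 0]`. Its first row reads off the coefficients of the words
`a ⋯ a` and `a ⋯ a b`. -/
def matrixRep (α β : V →ₗ[ℝ] ℝ) : TensorAlgebra ℝ V →ₐ[ℝ] Matrix (Fin 2) (Fin 2) ℝ :=
  TensorAlgebra.lift ℝ
    { toFun := fun v => !![α v, β v; 0, 0]
      map_add' := fun v w => by ext i j; fin_cases i <;> fin_cases j <;> simp
      map_smul' := fun c v => by ext i j; fin_cases i <;> fin_cases j <;> simp }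

/-- The functional dual to the words `a ⋯ a`. -/
def powFunctional (α β : V →ₗ[ℝ] ℝ) : Module.Dual ℝ (TensorAlgebra ℝ V) :=
  Matrix.entryLinearMap ℝ ℝ 0 0 ∘ₗ (matrixRep α β).toLinearMap

/-- The functional dual to the words `a ⋯ a b`. -/
def lastFunctional (α β : V →ₗ[ℝ] ℝ) : Module.Dual ℝ (TensorAlgebra ℝ V) :=
  Matrix.entryLinearMap ℝ ℝ 0 1 ∘ₗ (matrixRep α β).toLinearMap

variable (α β : V →ₗ[ℝ] ℝ)

theorem matrixRep_ι (v : V) :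
    matrixRep α β (TensorAlgebra.ι ℝ v) = !![α v, β v; 0, 0] := by
  simp [matrixRep]

theorem powFunctional_one : powFunctional α β 1 = 1 := by
  simp [powFunctional]

theorem powFunctional_mul_ι (z : TensorAlgebra ℝ V) (v : V) :
    powFunctional α β (z * TensorAlgebra.ι ℝ v) = powFunctional α β z * α v := by
  simp [powFunctional, matrixRep_ι, Matrix.mul_apply, Fin.sum_univ_two]

theorem lastFunctional_mul_ι (z : TensorAlgebra ℝ V) (v : V) :
    lastFunctional α β (z * TensorAlgebra.ι ℝ v) = powFunctional α β z * β v := by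
  simp [powFunctional, lastFunctional, matrixRep_ι, Matrix.mul_apply, Fin.sum_univ_two]

theorem lastFunctional_ι (v : V) : lastFunctional α β (TensorAlgebra.ι ℝ v) = β v := by
  simp [lastFunctional, matrixRep_ι]

/-- The representation sends `a` to the matrix unit with entry `1` at `(0, 0)`: multiplying by it on
the left preserves the `(0, 1)` entry, on the right it kills it. -/
theorem lastFunctional_commutator (a : V) (haα : α a = 1) (haβ : β a = 0)
    (z : TensorAlgebra ℝ V) :
    lastFunctional α β (TensorAlgebra.ι ℝ a * z - z * TensorAlgebra.ι ℝ a) =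
      lastFunctional α β z := by
  rw [map_sub, lastFunctional_mul_ι, haβ]
  simp only [lastFunctional, LinearMap.comp_apply, AlgHom.toLinearMap_apply, map_mul, matrixRep_ι,
    Matrix.entryLinearMap_apply, Matrix.mul_apply, Fin.sum_univ_two]
  simp [haα, haβ]

/-- All matrices in the image are upper triangular, so the top left entry is multiplicative. -/
theorem powFunctional_eq_lift (z : TensorAlgebra ℝ V) :
    powFunctional α β z = TensorAlgebra.lift ℝ α z := by
  induction z using TensorAlgebra.induction with
  | algebraMap r => simp [powFunctional, Algebra.algebraMap_eq_smul_one]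
  | ι v => simp [powFunctional, matrixRep_ι]
  | add x y hx hy => simp [hx, hy]
  | mul x y hx hy =>
    have hrow : ∀ w : TensorAlgebra ℝ V, matrixRep α β w 1 0 = 0 := by
      intro w
      induction w using TensorAlgebra.induction with
      | algebraMap r => simp [Algebra.algebraMap_eq_smul_one]
      | ι v => simp [matrixRep_ι]
      | add x y hx hy => simp [hx, hy]
      | mul x y hx hy => simp [Matrix.mul_apply, Fin.sum_univ_two, hx, hy]
    rw [map_mul (TensorAlgebra.lift ℝ α), ← hx, ← hy]
    simp [powFunctional, Matrix.mul_apply, Fin.sum_univ_two, hrow]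

/-- On `V^{⊗n}`, doubling through the coproduct multiplies a character by `2 ^ n`. -/
theorem lift_coproduct_of_mem_TPow {n : ℕ} {z : TensorAlgebra ℝ V} (hz : z ∈ TPow V n) :
    Algebra.TensorProduct.lift (TensorAlgebra.lift ℝ α) (TensorAlgebra.lift ℝ α)
      (fun _ _ => Commute.all _ _) (coproduct V z) = 2 ^ n * TensorAlgebra.lift ℝ α z := by
  induction n generalizing z with
  | zero =>
    rw [TPow, pow_zero, Submodule.one_eq_range] at hz
    obtain ⟨r, rfl⟩ := hz
    simp
  | succ n ih =>
    rw [TPow, pow_succ] at hz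
    refine Submodule.mul_induction_on hz ?_ ?_
    · rintro x hx _ ⟨v, rfl⟩
      rw [map_mul, map_mul, ih hx, map_mul]
      simp [coproduct]
      ring
    · intro x y hx hy
      simp only [map_add, hx, hy, mul_add]

/-- Applying the character twice to `Δ g = g ⊗ g` gives `2 ^ n A n = ∑ A i * A j`. The extreme terms
contribute `2 * A n`, and `2 ^ n ≠ 2` for `n ≥ 2`, so `A 0 = 1` and `A 1` determine the sequence;
the exponential sequence solves the same recursion. -/
theorem powFunctional_groupLike {g : TensorSeries V} (hg : g ∈ groupLike V) (n : ℕ) :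
    powFunctional α β (g n) = powFunctional α β (g 1) ^ n / n.factorial := by
  set A : ℕ → ℝ := fun n => powFunctional α β (g n) with hA
  have hA0 : A 0 = 1 := by simp [hA, hg.1, powFunctional_one]
  have hrec : ∀ n, 2 ^ n * A n = ∑ ij ∈ Finset.HasAntidiagonal.antidiagonal n, A ij.1 * A ij.2 := by
    intro n
    have h := congrArg (Algebra.TensorProduct.lift (TensorAlgebra.lift ℝ α)
      (TensorAlgebra.lift ℝ α) (fun _ _ => Commute.all _ _)) (hg.2 n)
    rw [lift_coproduct_of_mem_TPow α (g n).2, map_sum] at h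
    simpa [hA, powFunctional_eq_lift] using h
  change A n = A 1 ^ n / n.factorial
  induction n using Nat.strong_induction_on with
  | _ n ih =>
    match n with
    | 0 => simp [hA0]
    | 1 => simp
    | m + 2 =>
      have h1 := hrec (m + 2)
      have h2 := sum_antidiagonal_pow_div_factorial (A 1) (A 1) (m + 2)
      rw [Finset.Nat.sum_antidiagonal_succ, Finset.Nat.sum_antidiagonal_succ'] at h1 h2
      have h3 : ∑ p ∈ Finset.HasAntidiagonal.antidiagonal m, A (p.1 + 1) * A (p.2 + 1) =
          ∑ p ∈ Finset.HasAntidiagonal.antidiagonal m, A 1 ^ (p.1 + 1) / (p.1 + 1).factorial *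
            (A 1 ^ (p.2 + 1) / (p.2 + 1).factorial) := by
        refine Finset.sum_congr rfl fun p hp => ?_
        have hp' := Finset.HasAntidiagonal.mem_antidiagonal.1 hp
        rw [ih (p.1 + 1) (by omega), ih (p.2 + 1) (by omega)]
      simp only [hA0, h3] at h1
      simp only [pow_zero, Nat.factorial_zero, Nat.cast_one, div_one] at h2
      have h4 : (2 ^ (m + 2) - 2 : ℝ) *
          (A (m + 2) - A 1 ^ (m + 2) / (m + 2).factorial) = 0 := by
        rw [← two_mul, mul_pow] at h2
        linear_combination h1 + h2
      have h5 : (2 ^ (m + 2) - 2 : ℝ) ≠ 0 := by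
        have : (1 : ℝ) ≤ 2 ^ m := one_le_pow₀ (by norm_num)
        rw [pow_add]
        nlinarith
      exact sub_eq_zero.1 ((mul_eq_zero.1 h4).resolve_left h5)

end Algebra

/-! ### Increments of the words `a ⋯ a b` and Chen's relation -/

section Increments

variable {V : Type*} [AddCommGroup V] [Module ℝ V] (α β : V →ₗ[ℝ] ℝ)

/-- The coordinate `g ↦ α(g₁)` of a tensor series. -/
def levelOne (g : TensorSeries V) : ℝ := powFunctional α β (g 1)

/-- The generating series of the coefficients of the words `a ⋯ a b`. -/
def lastSeries (g : TensorSeries V) : PowerSeries ℝ :=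
  PowerSeries.mk fun k => lastFunctional α β (g (k + 1))

/-- For group-like `g` and `h`, the generating series of the coefficients of the words `a ⋯ a b` in
`g⁻¹ ⊗ h`. -/
def increment (g h : TensorSeries V) : PowerSeries ℝ :=
  PowerSeries.rescale (-levelOne α β g) (PowerSeries.exp ℝ) *
    (lastSeries α β h - lastSeries α β g)

theorem coeff_rescale_exp (x : ℝ) (i : ℕ) :
    PowerSeries.coeff i (PowerSeries.rescale x (PowerSeries.exp ℝ)) = x ^ i / i.factorial := by
  simp [PowerSeries.coeff_rescale, PowerSeries.coeff_exp, div_eq_mul_inv]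

theorem coeff_increment (g h : TensorSeries V) (k : ℕ) :
    PowerSeries.coeff k (increment α β g h) =
      ∑ ij ∈ Finset.HasAntidiagonal.antidiagonal k,
        (-levelOne α β g) ^ ij.1 / ij.1.factorial *
          (lastFunctional α β (h (ij.2 + 1)) - lastFunctional α β (g (ij.2 + 1))) := by
  rw [increment, PowerSeries.coeff_mul]
  simp only [coeff_rescale_exp, map_sub, lastSeries, PowerSeries.coeff_mk]

theorem increment_self (g : TensorSeries V) : increment α β g g = 0 := by
  simp [increment]

theorem rescale_exp_zero :
    PowerSeries.rescale (0 : ℝ) (PowerSeries.exp ℝ) = 1 := by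
  ext n
  rw [coeff_rescale_exp, PowerSeries.coeff_one]
  rcases n with _ | n <;> simp

theorem lastSeries_sub (g h : TensorSeries V) :
    lastSeries α β h - lastSeries α β g =
      PowerSeries.rescale (levelOne α β g) (PowerSeries.exp ℝ) * increment α β g h := by
  rw [increment, ← mul_assoc, PowerSeries.exp_mul_exp_eq_exp_add, add_neg_cancel,
    rescale_exp_zero, one_mul]

/-- Chen's relation. -/
theorem increment_chen (g h l : TensorSeries V) :
    increment α β g l = increment α β g h +
      PowerSeries.rescale (levelOne α β h - levelOne α β g) (PowerSeries.exp ℝ) *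
        increment α β h l := by
  have h1 : increment α β h l = PowerSeries.rescale (-levelOne α β h) (PowerSeries.exp ℝ) *
    (lastSeries α β l - lastSeries α β h) := rfl
  rw [h1, ← mul_assoc, PowerSeries.exp_mul_exp_eq_exp_add, increment, increment,
    show levelOne α β h - levelOne α β g + -levelOne α β h = -levelOne α β g by ring]
  ring

theorem coeff_increment_chen (g h l : TensorSeries V) (k : ℕ) :
    PowerSeries.coeff k (increment α β g l) =
      PowerSeries.coeff k (increment α β g h) + PowerSeries.coeff k (increment α β h l) +
      ∑ ij ∈ Finset.range k, (levelOne α β h - levelOne α β g) ^ (ij + 1) / (ij + 1).factorial *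
        PowerSeries.coeff (k - (ij + 1)) (increment α β h l) := by
  rw [increment_chen α β g h l, map_add, PowerSeries.coeff_mul,
    Finset.Nat.sum_antidiagonal_eq_sum_range_succ_mk, Finset.sum_range_succ', add_assoc]
  simp only [coeff_rescale_exp]
  simp [add_comm]

end Increments

/-! ### Increments along horizontal curves and the Carnot–Carathéodory distance -/

section Horizontal

/-- The iterated integrals of a curve, recentred at its starting point, are bounded by the powers
of its length. -/
theorem recentred_integrals {f w : ℝ → ℝ} (hf : IntegrableOn f (Icc 0 1))
    (hw : IntegrableOn w (Icc 0 1)) (hfw : ∀ r, |f r| ≤ w r) {a : ℕ → ℝ → ℝ} {x : ℝ} {N : ℕ}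
    (h0 : ∀ r ∈ Icc (0 : ℝ) 1, a 0 r = 1)
    (hsucc : ∀ j < N, ∀ r ∈ Icc (0 : ℝ) 1,
      a (j + 1) r = x ^ (j + 1) / (j + 1).factorial + ∫ s in (0 : ℝ)..r, a j s * f s) :
    (∀ k ≤ N, ContinuousOn (a k) (Icc 0 1)) ∧
    ∀ k ≤ N, ∀ r ∈ Icc (0 : ℝ) 1,
      |∑ ij ∈ Finset.HasAntidiagonal.antidiagonal k,
        (-x) ^ ij.1 / ij.1.factorial * a ij.2 r| ≤ (∫ s in (0 : ℝ)..1, w s) ^ k := by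
  have hcont : ∀ k ≤ N, ContinuousOn (a k) (Icc 0 1) := by
    intro k hk
    induction k with
    | zero => exact continuousOn_const.congr h0
    | succ k ih =>
      have hint : IntegrableOn (fun s => a k s * f s) (Icc 0 1) :=
        hf.continuousOn_mul (ih (by omega)) isCompact_Icc
      refine ContinuousOn.congr ?_ (hsucc k hk)
      have := intervalIntegral.continuousOn_primitive_interval
        (by rwa [uIcc_of_le zero_le_one] : IntegrableOn (fun s => a k s * f s) (uIcc 0 1))
      rw [uIcc_of_le zero_le_one] at this
      exact continuousOn_const.add this
  refine ⟨hcont, ?_⟩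
  have hw0 : ∀ s, 0 ≤ w s := fun s => (abs_nonneg _).trans (hfw s)
  have hwi : IntervalIntegrable w volume 0 1 :=
    (intervalIntegrable_iff_integrableOn_Icc_of_le zero_le_one).2 hw
  intro k
  induction k with
  | zero =>
    intro _ r hr
    simp [h0 r hr]
  | succ k ih =>
    intro hk r hr
    have hr1 : Icc 0 r ⊆ Icc (0 : ℝ) 1 := Icc_subset_Icc_right hr.2
    have hint : ∀ j ≤ k, IntervalIntegrable (fun s => a j s * f s) volume 0 r := fun j hj =>
      (intervalIntegrable_iff_integrableOn_Icc_of_le hr.1).2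
        ((hf.continuousOn_mul (hcont j (by omega)) isCompact_Icc).mono_set hr1)
    -- The recentred sum is an iterated integral started at zero: the initial values cancel because
    -- `exp (-x) * exp x = 1`.
    have key : ∑ ij ∈ Finset.HasAntidiagonal.antidiagonal (k + 1),
        (-x) ^ ij.1 / ij.1.factorial * a ij.2 r =
        ∫ s in (0 : ℝ)..r, (∑ ij ∈ Finset.HasAntidiagonal.antidiagonal k,
          (-x) ^ ij.1 / ij.1.factorial * a ij.2 s) * f s := by
      have h1 := sum_antidiagonal_pow_div_factorial (-x) x (k + 1)
      rw [neg_add_cancel, zero_pow (Nat.succ_ne_zero k), zero_div,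
        Finset.Nat.sum_antidiagonal_succ'] at h1
      rw [Finset.Nat.sum_antidiagonal_succ', h0 r hr]
      simp only [pow_zero, Nat.factorial_zero, Nat.cast_one, div_one] at h1
      have h2 : ∀ p ∈ Finset.HasAntidiagonal.antidiagonal k,
          (-x) ^ p.1 / p.1.factorial * a (p.2 + 1) r =
          (-x) ^ p.1 / p.1.factorial * (x ^ (p.2 + 1) / (p.2 + 1).factorial) +
            ∫ s in (0 : ℝ)..r, (-x) ^ p.1 / p.1.factorial * (a p.2 s * f s) := by
        intro p hp
        have := Finset.HasAntidiagonal.mem_antidiagonal.1 hp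
        rw [hsucc p.2 (by omega) r hr, mul_add, intervalIntegral.integral_const_mul]
      rw [Finset.sum_congr rfl h2, Finset.sum_add_distrib, ← add_assoc, h1, zero_add,
        ← intervalIntegral.integral_finsetSum]
      · simp only [Finset.sum_mul, mul_assoc]
      · intro p hp
        have := Finset.HasAntidiagonal.mem_antidiagonal.1 hp
        exact (hint p.2 (by omega)).const_mul _
    have hL : 0 ≤ ∫ s in (0 : ℝ)..1, w s :=
      intervalIntegral.integral_nonneg zero_le_one fun s _ => hw0 s
    rw [key, ← Real.norm_eq_abs]
    have hwr : IntervalIntegrable w volume 0 r :=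
      (intervalIntegrable_iff_integrableOn_Icc_of_le hr.1).2 (hw.mono_set hr1)
    calc _ ≤ ∫ s in (0 : ℝ)..r, (∫ s in (0 : ℝ)..1, w s) ^ k * w s := by
          refine intervalIntegral.norm_integral_le_of_norm_le hr.1 ?_ (hwr.const_mul _)
          refine Eventually.of_forall fun s hs => ?_
          rw [norm_mul, Real.norm_eq_abs, Real.norm_eq_abs]
          exact mul_le_mul (ih (by omega) s ⟨hs.1.le, hs.2.trans hr.2⟩) (hfw s) (abs_nonneg _)
            (by positivity)
      _ ≤ (∫ s in (0 : ℝ)..1, w s) ^ k * ∫ s in (0 : ℝ)..1, w s := by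
          rw [intervalIntegral.integral_const_mul]
          refine mul_le_mul_of_nonneg_left ?_ (by positivity)
          exact intervalIntegral.integral_mono_interval le_rfl hr.1 hr.2
            (Eventually.of_forall hw0) hwi
      _ = _ := (pow_succ _ _).symm

theorem ofReal_length {E : Type*} [NormedAddCommGroup E] {u : ℝ → E} (hu : IntegrableOn u (Icc 0 1)) :
    ENNReal.ofReal (∫ s in (0 : ℝ)..1, ‖u s‖) = ∫⁻ s in Icc (0 : ℝ) 1, ‖u s‖ₑ := by
  rw [intervalIntegral.integral_of_le zero_le_one, ← integral_Icc_eq_integral_Ioc]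
  exact ofReal_integral_norm_eq_lintegral_enorm hu

variable {V : Type*} [NormedAddCommGroup V] [InnerProductSpace ℝ V] {α β : V →ₗ[ℝ] ℝ}

theorem integrableOn_functional [FiniteDimensional ℝ V] {u : ℝ → V} {s : Set ℝ}
    (hu : IntegrableOn u s) (φ : V →ₗ[ℝ] ℝ) : IntegrableOn (fun r => φ (u r)) s :=
  (LinearMap.toContinuousLinearMap φ).integrable_comp hu

theorem abs_levelOne_sub_le_length [FiniteDimensional ℝ V] (hα : ∀ v, |α v| ≤ ‖v‖)
    {g h : TensorSeries V} (hg : g ∈ groupLike V) {n : ℕ} (hn : 1 ≤ n) {u : ℝ → V}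
    {Γ : ℝ → TruncTensor V n} (hΓ : IsHorizontal n u Γ) (hΓ0 : Γ 0 = trunc n g)
    (hΓ1 : Γ 1 = trunc n h) :
    |levelOne α β h - levelOne α β g| ≤ ∫ s in (0 : ℝ)..1, ‖u s‖ := by
  have h1 := hΓ.level_succ ⟨0, hn⟩ (powFunctional α β) 1 (by simp)
  have h2 : ∀ s ∈ Icc (0 : ℝ) 1, (Γ s (Fin.castSucc ⟨0, hn⟩) : TensorAlgebra ℝ V) = 1 := by
    intro s hs
    have := hΓ.level_zero s hs
    rw [hΓ0] at this
    exact (congrArg Subtype.val this).trans hg.1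
  have h3 : ∫ s in (0 : ℝ)..1, powFunctional α β
      ((Γ s (Fin.castSucc ⟨0, hn⟩) : TensorAlgebra ℝ V) * TensorAlgebra.ι ℝ (u s)) =
      ∫ s in (0 : ℝ)..1, α (u s) := by
    refine intervalIntegral.integral_congr fun s hs => ?_
    rw [uIcc_of_le zero_le_one] at hs
    simp only [powFunctional_mul_ι]
    rw [h2 s hs, powFunctional_one, one_mul]
  rw [h3, hΓ0, hΓ1] at h1
  have h4 : levelOne α β h - levelOne α β g = ∫ s in (0 : ℝ)..1, α (u s) :=
    sub_eq_iff_eq_add'.2 h1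
  rw [h4, ← Real.norm_eq_abs]
  exact intervalIntegral.norm_integral_le_of_norm_le zero_le_one
    (Eventually.of_forall fun s _ => hα _)
    ((intervalIntegrable_iff_integrableOn_Icc_of_le zero_le_one).2 hΓ.integrable.norm)

/-- The increment is the integral of `β (u s)` against the recentred `k`-fold integral of `α (u s)`,
and the latter is at most `L ^ k`. Group-likeness of `g` supplies the initial values `x ^ j / j!`.
-/
theorem abs_coeff_increment_le_length [FiniteDimensional ℝ V] (hα : ∀ v, |α v| ≤ ‖v‖)
    (hβ : ∀ v, |β v| ≤ ‖v‖) {g h : TensorSeries V} (hg : g ∈ groupLike V) {n k : ℕ}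
    (hk : k < n) {u : ℝ → V} {Γ : ℝ → TruncTensor V n} (hΓ : IsHorizontal n u Γ)
    (hΓ0 : Γ 0 = trunc n g) (hΓ1 : Γ 1 = trunc n h) :
    |PowerSeries.coeff k (increment α β g h)| ≤ (∫ s in (0 : ℝ)..1, ‖u s‖) ^ (k + 1) := by
  set a : ℕ → ℝ → ℝ := fun j r =>
    if hj : j < n + 1 then powFunctional α β (Γ r ⟨j, hj⟩) else 0 with ha
  have hu := hΓ.integrable
  have h0 : ∀ r ∈ Icc (0 : ℝ) 1, a 0 r = 1 := by
    intro r hr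
    have h1 : (Γ r 0 : TensorAlgebra ℝ V) = 1 := by
      have := hΓ.level_zero r hr
      rw [hΓ0] at this
      exact (congrArg Subtype.val this).trans hg.1
    have h2 : a 0 r = powFunctional α β (Γ r 0) := dif_pos (Nat.succ_pos n)
    rw [h2, h1, powFunctional_one]
  have hsucc : ∀ j < n, ∀ r ∈ Icc (0 : ℝ) 1, a (j + 1) r =
      levelOne α β g ^ (j + 1) / (j + 1).factorial + ∫ s in (0 : ℝ)..r, a j s * α (u s) := by
    intro j hj r hr
    have h1 := hΓ.level_succ ⟨j, hj⟩ (powFunctional α β) r hr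
    simp only [powFunctional_mul_ι] at h1
    have h2 : a (j + 1) r = powFunctional α β (Γ r (Fin.succ ⟨j, hj⟩)) :=
      dif_pos (Nat.succ_lt_succ hj)
    have h3 : ∀ s, a j s = powFunctional α β (Γ s (Fin.castSucc ⟨j, hj⟩)) := fun s =>
      dif_pos (hj.trans (Nat.lt_succ_self n))
    rw [h2, h1, hΓ0]
    simp only [h3]
    congr 1
    exact powFunctional_groupLike α β hg (j + 1)
  obtain ⟨hcont, hbound⟩ := recentred_integrals (integrableOn_functional hu α) hu.norm
    (fun r => hα (u r)) h0 hsucc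
  have hlast : ∀ j ≤ k, lastFunctional α β (h (j + 1)) - lastFunctional α β (g (j + 1)) =
      ∫ s in (0 : ℝ)..1, a j s * β (u s) := by
    intro j hj
    have hjn : j < n := by omega
    have h1 := hΓ.level_succ ⟨j, hjn⟩ (lastFunctional α β) 1 (by simp)
    simp only [lastFunctional_mul_ι] at h1
    have h3 : ∀ s, a j s = powFunctional α β (Γ s (Fin.castSucc ⟨j, hjn⟩)) := fun s =>
      dif_pos (hjn.trans (Nat.lt_succ_self n))
    simp only [h3]
    rw [hΓ0, hΓ1] at h1
    exact sub_eq_iff_eq_add'.2 h1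
  have hint : ∀ j ≤ k, IntervalIntegrable (fun s => a j s * β (u s)) volume 0 1 := fun j hj =>
    (intervalIntegrable_iff_integrableOn_Icc_of_le zero_le_one).2
      ((integrableOn_functional hu β).continuousOn_mul (hcont j (by omega)) isCompact_Icc)
  have key : PowerSeries.coeff k (increment α β g h) =
      ∫ s in (0 : ℝ)..1, (∑ ij ∈ Finset.HasAntidiagonal.antidiagonal k,
        (-levelOne α β g) ^ ij.1 / ij.1.factorial * a ij.2 s) * β (u s) := by
    rw [coeff_increment]
    have h2 : ∀ p ∈ Finset.HasAntidiagonal.antidiagonal k,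
        (-levelOne α β g) ^ p.1 / p.1.factorial *
          (lastFunctional α β (h (p.2 + 1)) - lastFunctional α β (g (p.2 + 1))) =
        ∫ s in (0 : ℝ)..1, (-levelOne α β g) ^ p.1 / p.1.factorial * (a p.2 s * β (u s)) := by
      intro p hp
      have := Finset.HasAntidiagonal.mem_antidiagonal.1 hp
      rw [hlast p.2 (by omega), intervalIntegral.integral_const_mul]
    rw [Finset.sum_congr rfl h2, ← intervalIntegral.integral_finsetSum]
    · simp only [Finset.sum_mul, mul_assoc]
    · intro p hp
      have := Finset.HasAntidiagonal.mem_antidiagonal.1 hp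
      exact (hint p.2 (by omega)).const_mul _
  rw [key, ← Real.norm_eq_abs, pow_succ, ← intervalIntegral.integral_const_mul]
  refine intervalIntegral.norm_integral_le_of_norm_le zero_le_one ?_
    (((intervalIntegrable_iff_integrableOn_Icc_of_le zero_le_one).2 hu.norm).const_mul _)
  refine Eventually.of_forall fun s hs => ?_
  rw [norm_mul, Real.norm_eq_abs, Real.norm_eq_abs]
  exact mul_le_mul (hbound k hk.le s ⟨hs.1.le, hs.2⟩) (hβ _) (abs_nonneg _)
    (pow_nonneg (intervalIntegral.integral_nonneg zero_le_one fun s _ => norm_nonneg _) _)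

theorem ofReal_abs_levelOne_sub_le [FiniteDimensional ℝ V] (hα : ∀ v, |α v| ≤ ‖v‖)
    {g h : TensorSeries V} (hg : g ∈ groupLike V) {n : ℕ} (hn : 1 ≤ n) :
    ENNReal.ofReal |levelOne α β h - levelOne α β g| ≤ ccDist n (trunc n g) (trunc n h) := by
  refine le_iInf fun u => le_iInf fun Γ => le_iInf fun hΓ => le_iInf fun h0 => le_iInf fun h1 => ?_
  rw [← ofReal_length hΓ.integrable]
  exact ENNReal.ofReal_le_ofReal (abs_levelOne_sub_le_length hα hg hn hΓ h0 h1)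

theorem ofReal_abs_coeff_increment_le [FiniteDimensional ℝ V] (hα : ∀ v, |α v| ≤ ‖v‖)
    (hβ : ∀ v, |β v| ≤ ‖v‖) {g h : TensorSeries V} (hg : g ∈ groupLike V) {n k : ℕ}
    (hk : k < n) :
    ENNReal.ofReal |PowerSeries.coeff k (increment α β g h)| ≤
      ccDist n (trunc n g) (trunc n h) ^ (k + 1) := by
  have hk1 : (0 : ℝ) < ((k + 1 : ℕ) : ℝ) := by positivity
  -- Taking the root first leaves the bare infimum on the right, so the bound can be checked curve
  -- by curve.
  rw [← ENNReal.rpow_natCast, ← ENNReal.rpow_inv_le_iff hk1]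
  refine le_iInf fun u => le_iInf fun Γ => le_iInf fun hΓ => le_iInf fun h0 => le_iInf fun h1 => ?_
  rw [ENNReal.rpow_inv_le_iff hk1, ENNReal.rpow_natCast, ← ofReal_length hΓ.integrable,
    ← ENNReal.ofReal_pow (intervalIntegral.integral_nonneg zero_le_one fun s _ => norm_nonneg _)]
  exact ENNReal.ofReal_le_ofReal (abs_coeff_increment_le_length hα hβ hg hk hΓ h0 h1)

end Horizontal

/-! ### Sewing estimates -/

section Sewing

/-- A discrete sewing estimate: an almost additive function differs from the sum of its values over
consecutive intervals by a multiple of the bound on its defect of additivity. -/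
theorem discrete_sewing {Ω y : ℕ → ℕ → ℝ} {K θ : ℝ} (hθ : 1 < θ) (hK : 0 ≤ K)
    (hΩ : ∀ i j, i ≤ j → 0 ≤ Ω i j)
    (hsup : ∀ i j k, i ≤ j → j ≤ k → Ω i j + Ω j k ≤ Ω i k)
    (hy : ∀ i j k, i ≤ j → j ≤ k → |y i k - y i j - y j k| ≤ K * Ω i k ^ θ)
    (hyy : ∀ i, y i i = 0) {i j : ℕ} (hij : i ≤ j) :
    |y i j - ∑ l ∈ Finset.Ico i j, y l (l + 1)| ≤ 2 / (1 - 2 ^ (1 - θ)) * K * Ω i j ^ θ := by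
  set c : ℝ := 2 / (1 - 2 ^ (1 - θ)) with hc
  have hpos : (0 : ℝ) < 1 - 2 ^ (1 - θ) :=
    sub_pos.2 (Real.rpow_lt_one_of_one_lt_of_neg one_lt_two (by linarith))
  have hc0 : 0 ≤ c := by positivity
  -- The constant is the fixed point of the recursion: each splitting costs two defects and leaves
  -- two intervals of at most half the control.
  have hceq : c = 2 + c * 2 ^ (1 - θ) := by
    have : c * (1 - 2 ^ (1 - θ)) = 2 := div_mul_cancel₀ _ hpos.ne'
    linarith
  have hΩself : ∀ i, Ω i i = 0 := fun i =>
    le_antisymm (by linarith [hsup i i i le_rfl le_rfl]) (hΩ i i le_rfl)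
  induction hn : j - i using Nat.strong_induction_on generalizing i j with
  | _ n ih =>
    rcases hij.eq_or_lt with rfl | hlt
    · simpa [hyy] using mul_nonneg (mul_nonneg hc0 hK) (Real.rpow_nonneg (hΩ i i le_rfl) θ)
    have hW := hΩ i j hij
    -- Without such an `m`, superadditivity would propagate `Ω i m ≤ Ω i j / 2` up to `m = j - 1`,
    -- where `Ω j j = 0` gives a contradiction.
    obtain ⟨m, him, hmj, hm1, hm2⟩ : ∃ m, i ≤ m ∧ m < j ∧ Ω i m ≤ Ω i j / 2 ∧
        Ω (m + 1) j ≤ Ω i j / 2 := by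
      by_contra! hcon
      have hall : ∀ m, i ≤ m → m < j → Ω i m ≤ Ω i j / 2 := by
        intro m him
        induction m, him using Nat.le_induction with
        | base => intro _; rw [hΩself]; positivity
        | succ m him ihm =>
          intro hm
          have h1 := hcon m him (by omega) (ihm (by omega))
          linarith [hsup i (m + 1) j (by omega) hm.le]
      have h1 := hcon (j - 1) (by omega) (by omega) (hall _ (by omega) (by omega))
      rw [Nat.sub_add_cancel (by omega : 1 ≤ j), hΩself] at h1
      linarith
    have e1 := hy i m j him hmj.le
    have e2 := hy m (m + 1) j (by omega) hmj
    have hmono : Ω m j ^ θ ≤ Ω i j ^ θ :=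
      Real.rpow_le_rpow (hΩ _ _ hmj.le) (by linarith [hsup i m j him hmj.le, hΩ i m him])
        (by linarith)
    have b1 := ih (m - i) (by omega) him rfl
    have b2 := ih (j - (m + 1)) (by omega) hmj rfl
    have hhalf : ∀ a, 0 ≤ a → a ≤ Ω i j / 2 → c * K * a ^ θ ≤ c * K * (Ω i j / 2) ^ θ :=
      fun a ha hle => mul_le_mul_of_nonneg_left (Real.rpow_le_rpow ha hle (by linarith))
        (mul_nonneg hc0 hK)
    have c1 := b1.trans (hhalf _ (hΩ _ _ him) hm1)
    have c2 := b2.trans (hhalf _ (hΩ _ _ hmj) hm2)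
    have hsum : ∑ l ∈ Finset.Ico i j, y l (l + 1) = ∑ l ∈ Finset.Ico i m, y l (l + 1) +
        y m (m + 1) + ∑ l ∈ Finset.Ico (m + 1) j, y l (l + 1) := by
      rw [← Finset.sum_Ico_consecutive _ him hmj.le, Finset.sum_eq_sum_Ico_succ_bot hmj, add_assoc]
    have hpow : (Ω i j / 2) ^ θ * 2 = 2 ^ (1 - θ) * Ω i j ^ θ := by
      rw [Real.div_rpow hW zero_le_two, Real.rpow_sub two_pos, Real.rpow_one]
      ring
    have hfin : c * K * Ω i j ^ θ = 2 * (K * Ω i j ^ θ) + c * K * (Ω i j / 2) ^ θ * 2 := by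
      rw [mul_assoc (c * K), hpow]
      linear_combination (K * Ω i j ^ θ) * hceq
    have e2' := e2.trans (mul_le_mul_of_nonneg_left hmono hK)
    rw [hsum, hfin]
    rw [abs_le] at *
    constructor <;> linarith [e1.1, e1.2, e2'.1, e2'.2, c1.1, c1.2, c2.1, c2.2]

/-- The sewing estimate for an almost additive function of two times. -/
theorem sewing {ω Y : ℝ → ℝ → ℝ} {K θ T : ℝ} (hθ : 1 < θ) (hK : 0 ≤ K)
    (hω : ∀ s t, 0 ≤ s → s ≤ t → t ≤ T → 0 ≤ ω s t)
    (hsup : ∀ s t u, 0 ≤ s → s ≤ t → t ≤ u → u ≤ T → ω s t + ω t u ≤ ω s u)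
    (hY : ∀ s t u, 0 ≤ s → s ≤ t → t ≤ u → u ≤ T → |Y s u - Y s t - Y t u| ≤ K * ω s u ^ θ)
    (hYY : ∀ s, Y s s = 0) {s t : ℝ} (hs : 0 ≤ s) (ht : t ≤ T)
    (hsmall : ∀ ε > 0, ∃ (τ : ℕ → ℝ) (m : ℕ), Monotone τ ∧ (∀ i, τ i ∈ Icc s t) ∧ τ 0 = s ∧
      τ m = t ∧ ∑ i ∈ Finset.range m, |Y (τ i) (τ (i + 1))| ≤ ε) :
    |Y s t| ≤ 2 / (1 - 2 ^ (1 - θ)) * K * ω s t ^ θ := by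
  refine le_of_forall_pos_le_add fun ε hε => ?_
  obtain ⟨τ, m, hτ, hmem, h0, hm, hsum⟩ := hsmall ε hε
  have hl : ∀ i, 0 ≤ τ i := fun i => hs.trans (hmem i).1
  have hr : ∀ i, τ i ≤ T := fun i => (hmem i).2.trans ht
  have key := discrete_sewing (Ω := fun i j => ω (τ i) (τ j)) (y := fun i j => Y (τ i) (τ j))
    hθ hK (fun i j hij => hω _ _ (hl i) (hτ hij) (hr j))
    (fun i j k hij hjk => hsup _ _ _ (hl i) (hτ hij) (hτ hjk) (hr k))
    (fun i j k hij hjk => hY _ _ _ (hl i) (hτ hij) (hτ hjk) (hr k))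
    (fun i => hYY _) (Nat.zero_le m)
  simp only [h0, hm, Nat.Ico_zero_eq_range] at key
  have h1 : |∑ i ∈ Finset.range m, Y (τ i) (τ (i + 1))| ≤ ε :=
    (Finset.abs_sum_le_sum_abs _ _).trans hsum
  calc |Y s t| = |(Y s t - ∑ i ∈ Finset.range m, Y (τ i) (τ (i + 1))) +
        ∑ i ∈ Finset.range m, Y (τ i) (τ (i + 1))| := by rw [sub_add_cancel]
    _ ≤ _ := (abs_add_le _ _).trans (add_le_add key h1)

/-- A continuous function of two times that vanishes on the diagonal and has finite `q`-variation
for some `q < 1` has arbitrarily small sums over partitions. -/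
theorem exists_partition_sum_le {Y : ℝ → ℝ → ℝ} {T q W : ℝ} (hq1 : q < 1)
    (hY : ContinuousOn (fun z : ℝ × ℝ => Y z.1 z.2) (Icc 0 T ×ˢ Icc 0 T)) (hYY : ∀ s, Y s s = 0)
    (hvar : ∀ (τ : ℕ → ℝ) (m : ℕ), Monotone τ → (∀ i, τ i ∈ Icc 0 T) →
      ∑ i ∈ Finset.range m, |Y (τ i) (τ (i + 1))| ^ q ≤ W)
    {s t : ℝ} (hs : 0 ≤ s) (hst : s ≤ t) (ht : t ≤ T) {ε : ℝ} (hε : 0 < ε) :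
    ∃ (τ : ℕ → ℝ) (m : ℕ), Monotone τ ∧ (∀ i, τ i ∈ Icc s t) ∧ τ 0 = s ∧
      τ m = t ∧ ∑ i ∈ Finset.range m, |Y (τ i) (τ (i + 1))| ≤ ε := by
  have hW : 0 ≤ W := by
    simpa using hvar (fun _ => s) 0 monotone_const (fun _ => ⟨hs, hst.trans ht⟩)
  -- If all increments are below `η`, then `|Y| ≤ η ^ (1 - q) * |Y| ^ q`, and the sum is at most `η
  -- ^ (1 - q) * W ≤ ε`.
  set η : ℝ := (ε / (W + 1)) ^ (1 - q)⁻¹ with hη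
  have hη0 : 0 < η := by positivity
  have hηε : η ^ (1 - q) * W ≤ ε := by
    rw [hη, Real.rpow_inv_rpow (by positivity) (by linarith), div_mul_eq_mul_div,
      div_le_iff₀ (by positivity)]
    nlinarith
  have huc := (isCompact_Icc.prod isCompact_Icc).uniformContinuousOn_of_continuous hY
  obtain ⟨δ, hδ, hδY⟩ := Metric.uniformContinuousOn_iff.1 huc η hη0
  obtain ⟨m, hm⟩ := exists_nat_gt ((t - s) / δ)
  have hm0 : 0 < (m : ℝ) := (div_nonneg (by linarith) hδ.le).trans_lt hm
  have hstep : (t - s) / m < δ := by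
    rw [div_lt_iff₀ hδ] at hm
    rw [div_lt_iff₀ hm0]
    linarith
  set τ : ℕ → ℝ := fun i => s + (t - s) * ((min i m : ℕ) / m) with hτdef
  have hτ : Monotone τ := by
    intro i j hij
    have : ((min i m : ℕ) : ℝ) ≤ (min j m : ℕ) := by exact_mod_cast min_le_min_right m hij
    have hts : 0 ≤ t - s := by linarith
    simp only [hτdef]
    gcongr
  have hmem' : ∀ i, τ i ∈ Icc s t := by
    intro i
    have h1 : ((min i m : ℕ) : ℝ) / m ≤ 1 :=
      (div_le_one hm0).2 (by exact_mod_cast min_le_right i m)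
    have h2 : 0 ≤ ((min i m : ℕ) : ℝ) / m := by positivity
    simp only [hτdef]
    constructor <;> nlinarith
  have hmem : ∀ i, τ i ∈ Icc 0 T := fun i => Icc_subset_Icc hs ht (hmem' i)
  refine ⟨τ, m, hτ, hmem', by simp [hτdef], by simp [hτdef, hm0.ne'], ?_⟩
  have hle : ∀ i ∈ Finset.range m, |Y (τ i) (τ (i + 1))| ≤
      η ^ (1 - q) * |Y (τ i) (τ (i + 1))| ^ q := by
    intro i hi
    have him := Finset.mem_range.1 hi
    have hd : dist ((τ i, τ (i + 1)) : ℝ × ℝ) (τ i, τ i) < δ := by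
      have h1 : τ (i + 1) - τ i = (t - s) / m := by
        simp only [hτdef, min_eq_left him.le, min_eq_left (Nat.succ_le_of_lt him)]
        push_cast
        ring
      rw [Prod.dist_eq, dist_self, Real.dist_eq, h1,
        abs_of_nonneg (div_nonneg (by linarith) hm0.le)]
      exact max_lt hδ hstep
    have h2 := hδY _ ⟨hmem i, hmem (i + 1)⟩ _ ⟨hmem i, hmem i⟩ hd
    simp only [hYY, dist_zero_right, Real.norm_eq_abs] at h2
    rcases (abs_nonneg (Y (τ i) (τ (i + 1)))).eq_or_lt with h0 | h0
    · rw [← h0]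
      positivity
    · calc |Y (τ i) (τ (i + 1))| = |Y (τ i) (τ (i + 1))| ^ (1 - q) *
            |Y (τ i) (τ (i + 1))| ^ q := by
            rw [← Real.rpow_add h0, sub_add_cancel, Real.rpow_one]
        _ ≤ _ := mul_le_mul_of_nonneg_right
            (Real.rpow_le_rpow h0.le h2.le (by linarith)) (by positivity)
  calc _ ≤ ∑ i ∈ Finset.range m, η ^ (1 - q) * |Y (τ i) (τ (i + 1))| ^ q := Finset.sum_le_sum hle
    _ = η ^ (1 - q) * ∑ i ∈ Finset.range m, |Y (τ i) (τ (i + 1))| ^ q :=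
        (Finset.mul_sum _ _ _).symm
    _ ≤ η ^ (1 - q) * W :=
        mul_le_mul_of_nonneg_left (hvar τ m hτ hmem) (by positivity)
    _ ≤ ε := hηε

end Sewing

/-! ### Controls of finite variation -/

section Control

/-- The supremum of the sums of `d` over finite increasing sequences in `[s, t]`. -/
def control (d : ℝ → ℝ → ℝ≥0∞) (s t : ℝ) : ℝ≥0∞ :=
  ⨆ q : ℕ × {τ : ℕ → ℝ // Monotone τ ∧ ∀ i, τ i ∈ Icc s t},
    ∑ i ∈ Finset.range q.1, d (q.2.1 i) (q.2.1 (i + 1))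

theorem sum_le_control (d : ℝ → ℝ → ℝ≥0∞) {s t : ℝ} {τ : ℕ → ℝ} (hτ : Monotone τ)
    (hmem : ∀ i, τ i ∈ Icc s t) (m : ℕ) :
    ∑ i ∈ Finset.range m, d (τ i) (τ (i + 1)) ≤ control d s t :=
  le_iSup (fun q : ℕ × {τ : ℕ → ℝ // Monotone τ ∧ ∀ i, τ i ∈ Icc s t} =>
    ∑ i ∈ Finset.range q.1, d (q.2.1 i) (q.2.1 (i + 1))) (m, ⟨τ, hτ, hmem⟩)

theorem le_control (d : ℝ → ℝ → ℝ≥0∞) {s t : ℝ} (hst : s ≤ t) : d s t ≤ control d s t := by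
  have h := sum_le_control d (s := s) (t := t) (τ := fun i => if i = 0 then s else t)
    (fun i j hij => by dsimp only; split_ifs <;> first | exact le_rfl | exact hst | omega)
    (fun i => by split_ifs <;> simp [hst]) 1
  simpa using h

theorem control_mono (d : ℝ → ℝ → ℝ≥0∞) {s t s' t' : ℝ} (hs : s' ≤ s) (ht : t ≤ t') :
    control d s t ≤ control d s' t' :=
  iSup_le fun q => sum_le_control d q.2.2.1 (fun i => Icc_subset_Icc hs ht (q.2.2.2 i)) q.1

theorem control_add_le (d : ℝ → ℝ → ℝ≥0∞) {s t u : ℝ} (hst : s ≤ t) (htu : t ≤ u) :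
    control d s t + control d t u ≤ control d s u := by
  have : Nonempty {τ : ℕ → ℝ // Monotone τ ∧ ∀ i, τ i ∈ Icc s t} :=
    ⟨⟨fun _ => s, monotone_const, fun _ => ⟨le_rfl, hst⟩⟩⟩
  have : Nonempty {τ : ℕ → ℝ // Monotone τ ∧ ∀ i, τ i ∈ Icc t u} :=
    ⟨⟨fun _ => t, monotone_const, fun _ => ⟨le_rfl, htu⟩⟩⟩
  refine ENNReal.iSup_add_iSup_le ?_
  rintro ⟨m, τ, hτ, hτm⟩ ⟨m', τ', hτ', hτm'⟩
  -- The concatenated sequence has one extra term, the jump from `τ m` to `τ' 0`, which is dropped.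
  have h := sum_le_control d (s := s) (t := u)
    (τ := fun i => if i ≤ m then τ i else τ' (i - (m + 1))) ?_ ?_ (m + 1 + m')
  · refine le_trans ?_ h
    rw [Finset.sum_range_add, Finset.sum_range_succ]
    refine add_le_add (le_add_right (Finset.sum_le_sum fun i hi => ?_))
      (Finset.sum_le_sum fun i hi => ?_)
    · have := Finset.mem_range.1 hi
      rw [if_pos this.le, if_pos (Nat.succ_le_of_lt this)]
    · rw [if_neg (by omega), if_neg (by omega), show m + 1 + i - (m + 1) = i by omega,
        show m + 1 + i + 1 - (m + 1) = i + 1 by omega]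
  · intro i j hij
    dsimp only
    split_ifs with h1 h2 h2
    · exact hτ hij
    · exact (hτm i).2.trans (hτm' _).1
    · omega
    · exact hτ' (by omega)
  · intro i
    split_ifs
    · exact ⟨(hτm i).1, (hτm i).2.trans htu⟩
    · exact ⟨hst.trans (hτm' _).1, (hτm' _).2⟩

/-- Finite `p`-variation implies finite `q`-variation for `p ≤ q`. -/
theorem control_rpow_lt_top {d : ℝ → ℝ → ℝ≥0∞} {p q s t : ℝ} (hp : 0 < p) (hpq : p ≤ q)
    (h : control (fun a b => d a b ^ p) s t < ∞) : control (fun a b => d a b ^ q) s t < ∞ := by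
  set W := control (fun a b => d a b ^ p) s t with hW
  have hle : control (fun a b => d a b ^ q) s t ≤ W ^ ((q - p) / p) * W := by
    refine iSup_le fun ⟨m, τ, hτ, hmem⟩ => ?_
    calc ∑ i ∈ Finset.range m, d (τ i) (τ (i + 1)) ^ q
        ≤ ∑ i ∈ Finset.range m, W ^ ((q - p) / p) * d (τ i) (τ (i + 1)) ^ p := by
          refine Finset.sum_le_sum fun i _ => ?_
          have h1 : d (τ i) (τ (i + 1)) ^ p ≤ W :=
            (le_control (fun a b => d a b ^ p) (hτ i.le_succ)).trans
              (control_mono _ (hmem i).1 (hmem _).2)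
          have h2 : d (τ i) (τ (i + 1)) ^ (q - p) ≤ W ^ ((q - p) / p) := by
            have := ENNReal.rpow_le_rpow h1 (div_nonneg (sub_nonneg.2 hpq) hp.le)
            rwa [← ENNReal.rpow_mul, mul_div_cancel₀ _ hp.ne'] at this
          calc d (τ i) (τ (i + 1)) ^ q
              = d (τ i) (τ (i + 1)) ^ (q - p) * d (τ i) (τ (i + 1)) ^ p := by
                rw [← ENNReal.rpow_add_of_nonneg _ _ (sub_nonneg.2 hpq) hp.le, sub_add_cancel]
            _ ≤ _ := mul_le_mul_left h2 _
      _ = W ^ ((q - p) / p) * ∑ i ∈ Finset.range m, d (τ i) (τ (i + 1)) ^ p :=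
          (Finset.mul_sum _ _ _).symm
      _ ≤ _ := mul_le_mul_right (sum_le_control (fun a b => d a b ^ p) hτ hmem m) _
  exact hle.trans_lt (ENNReal.mul_lt_top
    (ENNReal.rpow_lt_top_of_nonneg (div_nonneg (sub_nonneg.2 hpq) hp.le) h.ne) h)

/-- Comparison of a power of a distance with the control of its `P`-variation. -/
theorem le_toReal_rpow {y P : ℝ} {d c : ℝ≥0∞} {m : ℕ} (hP : 0 < P)
    (hy : ENNReal.ofReal y ≤ d ^ m) (hd : d ^ P ≤ c) (hc : c ≠ ∞) :
    y ≤ c.toReal ^ ((m : ℝ) / P) := by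
  have h1 : d ^ m ≤ c ^ ((m : ℝ) / P) := by
    have := ENNReal.rpow_le_rpow hd (by positivity : 0 ≤ (m : ℝ) / P)
    rwa [← ENNReal.rpow_mul, mul_div_cancel₀ _ hP.ne', ENNReal.rpow_natCast] at this
  have h2 := hy.trans h1
  rw [ENNReal.toReal_rpow]
  exact (ENNReal.ofReal_le_iff_le_toReal
    (ENNReal.rpow_lt_top_of_nonneg (by positivity) hc).ne).1 h2

end Control

/-! ### Extension estimate and growth bounds for signatures -/

section Lift

variable {V : Type*} [NormedAddCommGroup V] [InnerProductSpace ℝ V]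

/-- The path `S` of tensor series has `P`-variation controlled by `ω` in the degrees at most `P`,
and its increments in higher degrees have small sums over partitions. -/
structure IsControlled (α β : V →ₗ[ℝ] ℝ) (P : ℕ) (T : ℝ) (ω : ℝ → ℝ → ℝ)
    (S : ℝ → TensorSeries V) : Prop where
  nonneg : ∀ s t, 0 ≤ s → s ≤ t → t ≤ T → 0 ≤ ω s t
  superadd : ∀ s t u, 0 ≤ s → s ≤ t → t ≤ u → u ≤ T → ω s t + ω t u ≤ ω s u
  levelOne_le : ∀ s t, 0 ≤ s → s ≤ t → t ≤ T →
    |levelOne α β (S t) - levelOne α β (S s)| ≤ ω s t ^ ((1 : ℝ) / P)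
  increment_le : ∀ k < P, ∀ s t, 0 ≤ s → s ≤ t → t ≤ T →
    |PowerSeries.coeff k (increment α β (S s) (S t))| ≤ ω s t ^ (((k + 1 : ℕ) : ℝ) / P)
  small : ∀ k, P ≤ k → ∀ s t, 0 ≤ s → s ≤ t → t ≤ T → ∀ ε > 0,
    ∃ (τ : ℕ → ℝ) (m : ℕ), Monotone τ ∧ (∀ i, τ i ∈ Icc s t) ∧ τ 0 = s ∧ τ m = t ∧
      ∑ i ∈ Finset.range m,
        |PowerSeries.coeff k (increment α β (S (τ i)) (S (τ (i + 1))))| ≤ ε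

/-- The extension estimate: the increments of a controlled path are bounded in every degree, with
constants that depend only on the degree and on `P`. -/
theorem exists_increment_bound (α β : V →ₗ[ℝ] ℝ) {P : ℕ} (hP : 1 ≤ P) (k : ℕ) :
    ∃ C : ℝ, 0 ≤ C ∧ ∀ (T : ℝ) (ω : ℝ → ℝ → ℝ) (S : ℝ → TensorSeries V),
      IsControlled α β P T ω S → ∀ s t, 0 ≤ s → s ≤ t → t ≤ T →
        |PowerSeries.coeff k (increment α β (S s) (S t))| ≤
          C * ω s t ^ (((k + 1 : ℕ) : ℝ) / P) := by
  have hP0 : (0 : ℝ) < P := by exact_mod_cast hP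
  induction k using Nat.strong_induction_on with
  | _ k ih =>
    rcases lt_or_ge k P with hk | hk
    · refine ⟨1, zero_le_one, fun T ω S h s t hs hst ht => ?_⟩
      rw [one_mul]
      exact h.increment_le k hk s t hs hst ht
    choose! C hC0 hC using ih
    set θ : ℝ := ((k + 1 : ℕ) : ℝ) / P with hθ
    have hθ1 : 1 < θ := by
      rw [hθ, one_lt_div hP0]
      exact_mod_cast Nat.lt_succ_of_le hk
    -- By Chen's relation the defect of additivity in degree `k + 1` involves only increments of
    -- lower degree, so the earlier constants bound it.
    set K : ℝ := ∑ j ∈ Finset.range k, C (k - (j + 1)) with hKdef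
    have hK : 0 ≤ K := Finset.sum_nonneg fun j hj =>
      hC0 _ (by have := Finset.mem_range.1 hj; omega)
    have hpos : (0 : ℝ) < 1 - 2 ^ (1 - θ) :=
      sub_pos.2 (Real.rpow_lt_one_of_one_lt_of_neg one_lt_two (by linarith))
    refine ⟨2 / (1 - 2 ^ (1 - θ)) * K, by positivity, fun T ω S h s t hs hst ht => ?_⟩
    refine sewing (Y := fun s t => PowerSeries.coeff k (increment α β (S s) (S t))) hθ1 hK
      h.nonneg h.superadd ?_ (fun s => by simp [increment_self]) hs ht
      (h.small k hk s t hs hst ht)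
    intro s t u hs hst htu hu
    have hst0 := h.nonneg s t hs hst (htu.trans hu)
    have htu0 := h.nonneg t u (hs.trans hst) htu hu
    have hadd := h.superadd s t u hs hst htu hu
    rw [coeff_increment_chen α β (S s) (S t) (S u), add_assoc, add_sub_cancel_left,
      add_sub_cancel_left, hKdef, Finset.sum_mul]
    refine (Finset.abs_sum_le_sum_abs _ _).trans (Finset.sum_le_sum fun j hj => ?_)
    have hjk := Finset.mem_range.1 hj
    have h1 : |(levelOne α β (S t) - levelOne α β (S s)) ^ (j + 1) / (j + 1).factorial| ≤
        ω s u ^ (((j + 1 : ℕ) : ℝ) / P) := by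
      rw [abs_div, abs_pow, Nat.abs_cast]
      calc _ ≤ |levelOne α β (S t) - levelOne α β (S s)| ^ (j + 1) :=
            div_le_self (by positivity) (by exact_mod_cast Nat.factorial_pos (j + 1))
        _ ≤ (ω s t ^ ((1 : ℝ) / P)) ^ (j + 1) :=
            pow_le_pow_left₀ (abs_nonneg _) (h.levelOne_le s t hs hst (htu.trans hu)) _
        _ = ω s t ^ (((j + 1 : ℕ) : ℝ) / P) := by
            rw [← Real.rpow_natCast, ← Real.rpow_mul hst0]
            congr 1
            ring
        _ ≤ _ := Real.rpow_le_rpow hst0 (by linarith) (by positivity)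
    have h2 : |PowerSeries.coeff (k - (j + 1)) (increment α β (S t) (S u))| ≤
        C (k - (j + 1)) * ω s u ^ (((k - j : ℕ) : ℝ) / P) := by
      refine (hC (k - (j + 1)) (by omega) T ω S h t u (hs.trans hst) htu hu).trans ?_
      rw [show k - (j + 1) + 1 = k - j by omega]
      exact mul_le_mul_of_nonneg_left (Real.rpow_le_rpow htu0 (by linarith) (by positivity))
        (hC0 _ (by omega))
    rw [abs_mul]
    refine (mul_le_mul h1 h2 (abs_nonneg _)
      (Real.rpow_nonneg (by linarith) _)).trans (le_of_eq ?_)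
    -- The exponents `(j + 1) / P` and `(k - j) / P` add up to `θ`.
    rw [mul_left_comm, ← Real.rpow_add_of_nonneg (by linarith) (by positivity) (by positivity),
      hθ, ← add_div, ← Nat.cast_add, show j + 1 + (k - j) = k + 1 by omega]

theorem control_ccDist_lt_top {p q T : ℝ} (hp : 1 ≤ p) (hpq : p ≤ q) {n : ℕ}
    {X : ℝ → TruncTensor V n} (hX : IsPVarPath p T n X) :
    control (fun s t => ccDist n (X s) (X t) ^ q) 0 T < ∞ := by
  refine control_rpow_lt_top (zero_lt_one.trans_le hp) hpq ?_
  have h := hX.finite_pVar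
  by_contra hcon
  rw [not_lt, top_le_iff] at hcon
  have h2 : pVar p T n X = (control (fun s t => ccDist n (X s) (X t) ^ p) 0 T) ^ (1 / p) := rfl
  rw [h2, hcon, ENNReal.top_rpow_of_pos (by positivity)] at h
  exact lt_irrefl _ h

variable {α β : V →ₗ[ℝ] ℝ} [FiniteDimensional ℝ V]

section Continuity

variable {p T : ℝ} {X : ℝ → TruncTensor V ⌊p⌋₊} {S : ℝ → TensorSeries V}

theorem continuousOn_levelOne (hα : ∀ v, |α v| ≤ ‖v‖) (hS : IsLyonsLift p T X S) :
    ContinuousOn (fun t => levelOne α β (S t)) (Icc 0 T) := by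
  intro s hs
  have h1 := (hS.isPVarPath 1).continuous s hs
  rw [ContinuousWithinAt, tendsto_iff_edist_tendsto_0]
  refine tendsto_of_tendsto_of_tendsto_of_le_of_le tendsto_const_nhds h1
    (fun _ => zero_le) fun t => ?_
  rw [edist_dist, Real.dist_eq]
  exact ofReal_abs_levelOne_sub_le hα (hS.mem_groupLike s hs) le_rfl

theorem tendsto_coeff_increment (hα : ∀ v, |α v| ≤ ‖v‖) (hβ : ∀ v, |β v| ≤ ‖v‖)
    (hS : IsLyonsLift p T X S) (k : ℕ) {s : ℝ} (hs : s ∈ Icc 0 T) :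
    Tendsto (fun t => PowerSeries.coeff k (increment α β (S s) (S t))) (𝓝[Icc 0 T] s) (𝓝 0) := by
  have h1 := (hS.isPVarPath (k + 1)).continuous s hs
  have h2 := ENNReal.Tendsto.pow (n := k + 1) h1
  rw [zero_pow (Nat.succ_ne_zero k)] at h2
  rw [tendsto_iff_edist_tendsto_0]
  refine tendsto_of_tendsto_of_tendsto_of_le_of_le tendsto_const_nhds h2
    (fun _ => zero_le) fun t => ?_
  rw [edist_dist, Real.dist_eq, sub_zero]
  exact ofReal_abs_coeff_increment_le hα hβ (hS.mem_groupLike s hs) (Nat.lt_succ_self k)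

/-- Recentring at `s` writes the coefficient at `t` through increments from `s` to `t`, which vanish
as `t → s`. This upgrades continuity at the diagonal to the joint continuity in
`continuousOn_coeff_increment`. -/
theorem continuousOn_lastFunctional (hα : ∀ v, |α v| ≤ ‖v‖) (hβ : ∀ v, |β v| ≤ ‖v‖)
    (hS : IsLyonsLift p T X S) (k : ℕ) :
    ContinuousOn (fun t => lastFunctional α β (S t (k + 1))) (Icc 0 T) := by
  intro s hs
  have h1 : ∀ t, lastFunctional α β (S t (k + 1)) = lastFunctional α β (S s (k + 1)) +
      ∑ ij ∈ Finset.HasAntidiagonal.antidiagonal k,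
        levelOne α β (S s) ^ ij.1 / ij.1.factorial *
          PowerSeries.coeff ij.2 (increment α β (S s) (S t)) := by
    intro t
    have h := congrArg (PowerSeries.coeff k) (lastSeries_sub α β (S s) (S t))
    rw [PowerSeries.coeff_mul, map_sub, lastSeries, lastSeries, PowerSeries.coeff_mk,
      PowerSeries.coeff_mk] at h
    simp only [coeff_rescale_exp] at h
    linarith
  refine ContinuousWithinAt.congr ?_ (fun t _ => h1 t) (h1 s)
  have h2 : Tendsto (fun t => ∑ ij ∈ Finset.HasAntidiagonal.antidiagonal k,
        levelOne α β (S s) ^ ij.1 / ij.1.factorial *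
          PowerSeries.coeff ij.2 (increment α β (S s) (S t))) (𝓝[Icc 0 T] s)
      (𝓝 (∑ ij ∈ Finset.HasAntidiagonal.antidiagonal k,
        levelOne α β (S s) ^ ij.1 / ij.1.factorial * 0)) :=
    tendsto_finsetSum _ fun ij _ => (tendsto_coeff_increment hα hβ hS ij.2 hs).const_mul _
  rw [ContinuousWithinAt]
  simpa only [increment_self, map_zero] using h2.const_add (lastFunctional α β (S s (k + 1)))

theorem continuousOn_coeff_increment (hα : ∀ v, |α v| ≤ ‖v‖) (hβ : ∀ v, |β v| ≤ ‖v‖)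
    (hS : IsLyonsLift p T X S) (k : ℕ) :
    ContinuousOn (fun z : ℝ × ℝ => PowerSeries.coeff k (increment α β (S z.1) (S z.2)))
      (Icc 0 T ×ˢ Icc 0 T) := by
  have hfst : MapsTo (Prod.fst : ℝ × ℝ → ℝ) (Icc 0 T ×ˢ Icc 0 T) (Icc 0 T) := fun z hz => hz.1
  have hsnd : MapsTo (Prod.snd : ℝ × ℝ → ℝ) (Icc 0 T ×ˢ Icc 0 T) (Icc 0 T) := fun z hz => hz.2
  simp only [coeff_increment]
  refine continuousOn_finsetSum _ fun ij _ => ContinuousOn.mul ?_ (ContinuousOn.sub ?_ ?_)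
  · exact (((continuousOn_levelOne (β := β) hα hS).comp continuousOn_fst hfst).neg.pow _).div_const _
  · exact (continuousOn_lastFunctional hα hβ hS ij.2).comp continuousOn_snd hsnd
  · exact (continuousOn_lastFunctional hα hβ hS ij.2).comp continuousOn_fst hfst

end Continuity

/-- The Lyons lift of a weakly geometric `p`-rough path is controlled by its `P`-variation in degree
`P` for every natural number `P ≥ p`. -/
theorem isControlled_of_isLyonsLift (hα : ∀ v, |α v| ≤ ‖v‖) (hβ : ∀ v, |β v| ≤ ‖v‖)
    {p T : ℝ} (hp : 1 ≤ p) {P : ℕ} (hpP : p ≤ P) {X : ℝ → TruncTensor V ⌊p⌋₊}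
    {S : ℝ → TensorSeries V} (hS : IsLyonsLift p T X S) :
    IsControlled α β P T
      (fun s t => (control (fun s t => ccDist P (trunc P (S s)) (trunc P (S t)) ^ (P : ℝ))
        s t).toReal) S := by
  have hP1 : (1 : ℝ) ≤ P := hp.trans hpP
  have hP0 : (0 : ℝ) < P := by linarith
  have hPn : 1 ≤ P := by exact_mod_cast hP1
  have hfin : ∀ s t, 0 ≤ s → t ≤ T →
      control (fun s t => ccDist P (trunc P (S s)) (trunc P (S t)) ^ (P : ℝ)) s t ≠ ∞ :=
    fun s t hs ht => ((control_mono _ hs ht).trans_lt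
      (control_ccDist_lt_top hp hpP (hS.isPVarPath P))).ne
  refine ⟨fun _ _ _ _ _ => ENNReal.toReal_nonneg, ?_, ?_, ?_, ?_⟩
  · intro s t u hs hst htu hu
    rw [← ENNReal.toReal_add (hfin s t hs (htu.trans hu)) (hfin t u (hs.trans hst) hu)]
    exact ENNReal.toReal_mono (hfin s u hs hu) (control_add_le _ hst htu)
  · intro s t hs hst ht
    have h := le_toReal_rpow (m := 1) hP0 (by
      rw [pow_one]
      exact ofReal_abs_levelOne_sub_le (β := β) (h := S t) hα
        (hS.mem_groupLike s ⟨hs, hst.trans ht⟩) hPn) (le_control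
          (fun s t => ccDist P (trunc P (S s)) (trunc P (S t)) ^ (P : ℝ)) hst) (hfin s t hs ht)
    simpa using h
  · intro k hk s t hs hst ht
    exact le_toReal_rpow hP0 (ofReal_abs_coeff_increment_le hα hβ
      (hS.mem_groupLike s ⟨hs, hst.trans ht⟩) hk) (le_control
        (fun s t => ccDist P (trunc P (S s)) (trunc P (S t)) ^ (P : ℝ)) hst) (hfin s t hs ht)
  · intro k hk s t hs hst ht ε hε
    have hk0 : (0 : ℝ) < ((k + 1 : ℕ) : ℝ) := by positivity
    -- The increment is at most the distance to the power `k + 1`, so its `q`-th power is summable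
    -- by finite `P`-variation at level `k + 1`; and `q < 1` since `P ≤ k`.
    set q : ℝ := P / ((k + 1 : ℕ) : ℝ) with hq
    have hq1 : q < 1 := by
      rw [hq, div_lt_one hk0]
      exact_mod_cast Nat.lt_succ_of_le hk
    have hW := control_ccDist_lt_top hp hpP (hS.isPVarPath (k + 1))
    refine exists_partition_sum_le
      (Y := fun s t => PowerSeries.coeff k (increment α β (S s) (S t))) hq1
      (continuousOn_coeff_increment hα hβ hS k) (fun s => by simp [increment_self])
      (W := (control (fun s t => ccDist (k + 1) (trunc (k + 1) (S s)) (trunc (k + 1) (S t)) ^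
        (P : ℝ)) 0 T).toReal) ?_ hs hst ht hε
    intro τ m hτ hmem
    rw [← ENNReal.ofReal_le_iff_le_toReal hW.ne, ENNReal.ofReal_sum_of_nonneg fun i _ => by positivity]
    refine le_trans (Finset.sum_le_sum fun i _ => ?_) (sum_le_control
      (fun s t => ccDist (k + 1) (trunc (k + 1) (S s)) (trunc (k + 1) (S t)) ^ (P : ℝ)) hτ hmem m)
    rw [← ENNReal.ofReal_rpow_of_nonneg (abs_nonneg _) (by positivity)]
    have h := ENNReal.rpow_le_rpow (ofReal_abs_coeff_increment_le hα hβ (h := S (τ (i + 1)))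
      (hS.mem_groupLike (τ i) (hmem i)) (Nat.lt_succ_self k)) (by positivity : 0 ≤ q)
    refine h.trans (le_of_eq ?_)
    rw [← ENNReal.rpow_natCast, ← ENNReal.rpow_mul, hq, mul_div_cancel₀ _ hk0.ne']

/-- There are countably many growth bounds such that the coefficients of the words `a ⋯ a b` of any
signature satisfy one of them. -/
theorem exists_growth_bounds (hα : ∀ v, |α v| ≤ ‖v‖) (hβ : ∀ v, |β v| ≤ ‖v‖) {T : ℝ}
    (hT : 0 ≤ T) :
    ∃ C : ℕ → ℕ → ℕ → ℝ, ∀ g ∈ signatures V T, ∃ P w, ∀ k,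
      |lastFunctional α β (g (k + 1))| ≤ C P w k := by
  choose C hC0 hC using fun (P : {P : ℕ // 1 ≤ P}) k => exists_increment_bound α β P.2 k
  -- The index `P` stands for `⌊p⌋₊`, so the variation exponent is the integer `P + 1 ≥ p`; `w`
  -- bounds the control over `[0, T]`.
  refine ⟨fun P w k => C ⟨P + 1, Nat.le_add_left 1 P⟩ k *
    (w : ℝ) ^ (((k + 1 : ℕ) : ℝ) / ((P + 1 : ℕ) : ℝ)), ?_⟩
  intro g hg
  simp only [signatures, mem_iUnion] at hg
  obtain ⟨p, hp, X, -, S, hS, rfl⟩ := hg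
  have hpP : p ≤ ((⌊p⌋₊ + 1 : ℕ) : ℝ) := by
    push_cast
    exact (Nat.lt_floor_add_one p).le
  have hctrl := isControlled_of_isLyonsLift hα hβ hp hpP hS
  obtain ⟨w, hw⟩ := exists_nat_ge (control (fun s t => ccDist (⌊p⌋₊ + 1)
    (trunc (⌊p⌋₊ + 1) (S s)) (trunc (⌊p⌋₊ + 1) (S t)) ^ ((⌊p⌋₊ + 1 : ℕ) : ℝ)) 0 T).toReal
  refine ⟨⌊p⌋₊, w, fun k => ?_⟩
  have h := hC ⟨⌊p⌋₊ + 1, Nat.le_add_left 1 _⟩ k T _ S hctrl 0 T le_rfl hT le_rfl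
  have h1 : levelOne α β (S 0) = 0 := by
    rw [hS.start, levelOne]
    exact map_zero _
  have h2 : PowerSeries.coeff k (increment α β (S 0) (S T)) =
      lastFunctional α β (S T (k + 1)) := by
    have h3 : lastSeries α β (S 0) = 0 := by
      ext j
      rw [hS.start, lastSeries, PowerSeries.coeff_mk]
      exact map_zero _
    rw [increment, h1, neg_zero, rescale_exp_zero, one_mul, h3, sub_zero, lastSeries,
      PowerSeries.coeff_mk]
  rw [h2] at h
  exact h.trans (mul_le_mul_of_nonneg_left
    (Real.rpow_le_rpow ENNReal.toReal_nonneg hw (by positivity)) (hC0 _ _))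

end Lift

/-! ### Group-like elements with prescribed growth -/

section Perturbation

/-- The exponential `∑ₖ aᵏ Xᵐᵏ / k!` of `a Xᵐ`. -/
def expMonomial {A : Type*} [Ring A] [Algebra ℝ A] (m : ℕ) (a : A) : PowerSeries A :=
  PowerSeries.mk fun n => if m ∣ n then ((n / m).factorial : ℝ)⁻¹ • a ^ (n / m) else 0

/-- Only pairs of multiples of `m` contribute to the product, and on these the identity is the
binomial theorem for commuting elements. -/
theorem expMonomial_add {A : Type*} [Ring A] [Algebra ℝ A] {m : ℕ} (hm : 0 < m) {a b : A}
    (hab : Commute a b) : expMonomial m (a + b) = expMonomial m a * expMonomial m b := by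
  ext n
  rw [PowerSeries.coeff_mul]
  simp only [expMonomial, PowerSeries.coeff_mk]
  split_ifs with h
  · obtain ⟨q, rfl⟩ := h
    rw [Nat.mul_div_cancel_left q hm, hab.add_pow' q, Finset.smul_sum]
    symm
    refine Finset.sum_of_injOn (s := Finset.HasAntidiagonal.antidiagonal q)
      (fun ij => (m * ij.1, m * ij.2)) ?_ ?_ ?_ ?_ |>.symm
    · rintro ⟨i, j⟩ - ⟨i', j'⟩ - h
      simpa [hm.ne'] using h
    · intro ij hij
      rw [Finset.mem_coe, Finset.HasAntidiagonal.mem_antidiagonal] at hij ⊢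
      rw [← mul_add, hij]
    · rintro ⟨i, j⟩ hij hnot
      rw [Finset.HasAntidiagonal.mem_antidiagonal] at hij
      by_cases hi : m ∣ i
      · obtain ⟨i', rfl⟩ := hi
        obtain ⟨j', rfl⟩ : m ∣ j := (Nat.dvd_add_right (dvd_mul_right m i')).1 ⟨q, hij⟩
        refine absurd ⟨(i', j'), ?_, rfl⟩ hnot
        rw [Finset.mem_coe, Finset.HasAntidiagonal.mem_antidiagonal]
        exact Nat.eq_of_mul_eq_mul_left hm (by rw [mul_add]; exact hij)
      · simp [hi]
    · rintro ⟨i, j⟩ hij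
      obtain rfl : i + j = q := Finset.HasAntidiagonal.mem_antidiagonal.1 hij
      simp only [dvd_mul_right, if_true, Nat.mul_div_cancel_left _ hm]
      rw [smul_mul_smul_comm, ← Nat.cast_smul_eq_nsmul ℝ, smul_smul, Nat.cast_add_choose]
      congr 1
      field_simp
  · symm
    refine Finset.sum_eq_zero fun ij hij => ?_
    rw [Finset.HasAntidiagonal.mem_antidiagonal] at hij
    by_cases h1 : m ∣ ij.1
    · have h2 : ¬ m ∣ ij.2 := fun h2 => h (hij ▸ dvd_add h1 h2)
      simp [h2]
    · simp [h1]

theorem map_expMonomial {A B : Type*} [Ring A] [Algebra ℝ A] [Ring B] [Algebra ℝ B]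
    (f : A →ₐ[ℝ] B) (m : ℕ) (a : A) :
    PowerSeries.map (f : A →+* B) (expMonomial m a) = expMonomial m (f a) := by
  ext n
  simp only [expMonomial, PowerSeries.coeff_map, PowerSeries.coeff_mk]
  split_ifs <;> simp

variable {V : Type*} [AddCommGroup V] [Module ℝ V]

/-- The tensor square of the tensor algebra. -/
abbrev TensorSquare (V : Type*) [AddCommGroup V] [Module ℝ V] : Type _ :=
  TensorAlgebra ℝ V ⊗[ℝ] TensorAlgebra ℝ V

/-- The left inclusion of the tensor algebra in its tensor square. -/
abbrev inclLeft (V : Type*) [AddCommGroup V] [Module ℝ V] :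
    TensorAlgebra ℝ V →ₐ[ℝ] TensorSquare V :=
  Algebra.TensorProduct.includeLeft

/-- The right inclusion of the tensor algebra in its tensor square. -/
abbrev inclRight (V : Type*) [AddCommGroup V] [Module ℝ V] :
    TensorAlgebra ℝ V →ₐ[ℝ] TensorSquare V :=
  Algebra.TensorProduct.includeRight

theorem inclLeft_commute_inclRight (x y : TensorAlgebra ℝ V) :
    Commute (inclLeft V x) (inclRight V y) := by
  simp [Commute, SemiconjBy]

/-- A tensor series as a power series with coefficients in the tensor algebra. -/
def toPowerSeries (g : TensorSeries V) : PowerSeries (TensorAlgebra ℝ V) :=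
  PowerSeries.mk fun n => (g n : TensorAlgebra ℝ V)

/-- A power series over the tensor algebra is group-like for the coproduct. -/
def IsGroupLikeSeries (F : PowerSeries (TensorAlgebra ℝ V)) : Prop :=
  PowerSeries.map (coproduct V : TensorAlgebra ℝ V →+* TensorSquare V) F =
    PowerSeries.map (inclLeft V : TensorAlgebra ℝ V →+* TensorSquare V) F *
      PowerSeries.map (inclRight V : TensorAlgebra ℝ V →+* TensorSquare V) F

theorem mem_groupLike_iff (g : TensorSeries V) :
    g ∈ groupLike V ↔ (g 0 : TensorAlgebra ℝ V) = 1 ∧ IsGroupLikeSeries (toPowerSeries g) := by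
  refine and_congr Iff.rfl ?_
  rw [IsGroupLikeSeries, PowerSeries.ext_iff]
  refine forall_congr' fun n => ?_
  simp [PowerSeries.coeff_mul, toPowerSeries]

/-- The coproduct is multiplicative and the two inclusions have commuting images, so the factors can
be regrouped. -/
theorem IsGroupLikeSeries.mul {F G : PowerSeries (TensorAlgebra ℝ V)} (hF : IsGroupLikeSeries F)
    (hG : IsGroupLikeSeries G) : IsGroupLikeSeries (F * G) := by
  have hcomm : PowerSeries.map (inclLeft V : TensorAlgebra ℝ V →+* TensorSquare V) G *
      PowerSeries.map (inclRight V : TensorAlgebra ℝ V →+* TensorSquare V) F =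
      PowerSeries.map (inclRight V : TensorAlgebra ℝ V →+* TensorSquare V) F *
        PowerSeries.map (inclLeft V : TensorAlgebra ℝ V →+* TensorSquare V) G := by
    ext n
    rw [PowerSeries.coeff_mul, PowerSeries.coeff_mul, ← Finset.Nat.sum_antidiagonal_swap]
    refine Finset.sum_congr rfl fun ij _ => ?_
    simp only [PowerSeries.coeff_map, Prod.fst_swap, Prod.snd_swap]
    exact inclLeft_commute_inclRight _ _
  rw [IsGroupLikeSeries] at *
  rw [map_mul, map_mul, map_mul, hF, hG, mul_assoc, mul_assoc]
  congr 1
  rw [← mul_assoc, ← mul_assoc, hcomm]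

/-- An element of the tensor algebra is primitive for the coproduct. -/
def IsPrimitiveTensor (z : TensorAlgebra ℝ V) : Prop :=
  coproduct V z = inclLeft V z + inclRight V z

theorem isPrimitiveTensor_ι (v : V) : IsPrimitiveTensor (TensorAlgebra.ι ℝ v) := by
  simp [IsPrimitiveTensor, coproduct]

theorem IsPrimitiveTensor.commutator {x y : TensorAlgebra ℝ V} (hx : IsPrimitiveTensor x)
    (hy : IsPrimitiveTensor y) : IsPrimitiveTensor (x * y - y * x) := by
  rw [IsPrimitiveTensor] at *
  have h1 := (inclLeft_commute_inclRight x y).eq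
  have h2 := (inclLeft_commute_inclRight y x).eq
  rw [map_sub, map_mul, map_mul, hx, hy, map_sub, map_sub, map_mul, map_mul, map_mul, map_mul,
    add_mul, mul_add, mul_add, add_mul, mul_add, mul_add, h1, h2]
  abel

theorem IsPrimitiveTensor.smul {x : TensorAlgebra ℝ V} (hx : IsPrimitiveTensor x) (c : ℝ) :
    IsPrimitiveTensor (c • x) := by
  rw [IsPrimitiveTensor] at *
  rw [map_smul, map_smul, map_smul, hx, smul_add]

/-- The exponential turns the sum of the commuting elements `z ⊗ 1` and `1 ⊗ z` into a product. -/
theorem IsPrimitiveTensor.isGroupLikeSeries_expMonomial {z : TensorAlgebra ℝ V}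
    (hz : IsPrimitiveTensor z) {m : ℕ} (hm : 0 < m) : IsGroupLikeSeries (expMonomial m z) := by
  rw [IsGroupLikeSeries, map_expMonomial, map_expMonomial, map_expMonomial, hz,
    expMonomial_add hm (inclLeft_commute_inclRight z z)]

/-- The iterated commutator `[a, [a, … [a, b]]]` with `k` letters `a`. -/
def iteratedCommutator (a b : V) : ℕ → TensorAlgebra ℝ V
  | 0 => TensorAlgebra.ι ℝ b
  | k + 1 => TensorAlgebra.ι ℝ a * iteratedCommutator a b k -
      iteratedCommutator a b k * TensorAlgebra.ι ℝ a

theorem isPrimitiveTensor_iteratedCommutator (a b : V) (k : ℕ) :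
    IsPrimitiveTensor (iteratedCommutator a b k) := by
  induction k with
  | zero => exact isPrimitiveTensor_ι b
  | succ k ih => exact (isPrimitiveTensor_ι a).commutator ih

theorem iteratedCommutator_mem (a b : V) (k : ℕ) : iteratedCommutator a b k ∈ TPow V (k + 1) := by
  induction k with
  | zero => rw [TPow, zero_add, pow_one]; exact ⟨b, rfl⟩
  | succ k ih =>
    refine Submodule.sub_mem _ ?_ ?_
    · rw [TPow, pow_succ']
      exact Submodule.mul_mem_mul ⟨a, rfl⟩ ih
    · rw [TPow, pow_succ]
      exact Submodule.mul_mem_mul ih ⟨a, rfl⟩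

theorem lastFunctional_iteratedCommutator {α β : V →ₗ[ℝ] ℝ} {a b : V} (haα : α a = 1)
    (haβ : β a = 0) (hb : β b = 1) (k : ℕ) :
    lastFunctional α β (iteratedCommutator a b k) = 1 := by
  induction k with
  | zero => rw [iteratedCommutator, lastFunctional_ι, hb]
  | succ k ih => rw [iteratedCommutator, lastFunctional_commutator α β a haα haβ, ih]

theorem coeff_expMonomial_mem {m : ℕ} {z : TensorAlgebra ℝ V} (hz : z ∈ TPow V m) (n : ℕ) :
    PowerSeries.coeff n (expMonomial m z) ∈ TPow V n := by
  rw [expMonomial, PowerSeries.coeff_mk]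
  split_ifs with h
  · refine Submodule.smul_mem _ _ ?_
    have h1 := Submodule.pow_mem_pow _ hz (n / m)
    rwa [TPow, ← pow_mul, Nat.mul_div_cancel' h] at h1
  · exact Submodule.zero_mem _

/-- Right multiplication of a group-like series by the exponential of a homogeneous primitive
element of degree `m` changes it only in degrees at least `m`, and adds that element in degree `m`. -/
theorem exists_groupLike_perturbation {g : TensorSeries V} (hg : g ∈ groupLike V) {m : ℕ}
    (hm : 0 < m) {z : TensorAlgebra ℝ V} (hz : z ∈ TPow V m) (hzp : IsPrimitiveTensor z) :
    ∃ h ∈ groupLike V, (∀ i < m, h i = g i) ∧ (h m : TensorAlgebra ℝ V) = g m + z := by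
  have hmem : ∀ n, PowerSeries.coeff n (toPowerSeries g * expMonomial m z) ∈ TPow V n := by
    intro n
    rw [PowerSeries.coeff_mul]
    refine Submodule.sum_mem _ fun ij hij => ?_
    obtain rfl : ij.1 + ij.2 = n := Finset.HasAntidiagonal.mem_antidiagonal.1 hij
    rw [TPow, pow_add, toPowerSeries, PowerSeries.coeff_mk]
    exact Submodule.mul_mem_mul (g ij.1).2 (coeff_expMonomial_mem hz ij.2)
  have h0 : PowerSeries.coeff 0 (expMonomial m z) = 1 := by simp [expMonomial]
  have hlow : ∀ i, 0 < i → i < m → PowerSeries.coeff i (expMonomial m z) = 0 := by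
    intro i hi him
    rw [expMonomial, PowerSeries.coeff_mk, if_neg fun h => absurd (Nat.le_of_dvd hi h) (by omega)]
  have heq : ∀ i < m, PowerSeries.coeff i (toPowerSeries g * expMonomial m z) = g i := by
    intro i hi
    rw [PowerSeries.coeff_mul, Finset.sum_eq_single (i, 0)]
    · simp [h0, toPowerSeries]
    · rintro ⟨j, l⟩ hjl hne
      have := Finset.HasAntidiagonal.mem_antidiagonal.1 hjl
      have hl : l ≠ 0 := by
        rintro rfl
        exact hne (by simpa using this)
      rw [hlow l (by omega) (by dsimp only at this; omega), mul_zero]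
    · simp
  refine ⟨fun n => ⟨_, hmem n⟩, ?_, fun i hi => Subtype.ext (heq i hi), ?_⟩
  · rw [mem_groupLike_iff] at hg ⊢
    refine ⟨(heq 0 hm).trans hg.1, ?_⟩
    have : toPowerSeries (fun n => ⟨_, hmem n⟩) = toPowerSeries g * expMonomial m z := by
      ext n
      simp [toPowerSeries]
    rw [this]
    exact hg.2.mul (hzp.isGroupLikeSeries_expMonomial hm)
  · change PowerSeries.coeff m (toPowerSeries g * expMonomial m z) = _
    rw [PowerSeries.coeff_mul, Finset.sum_eq_add (m, 0) (0, m)]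
    · have hc : PowerSeries.coeff m (expMonomial m z) = z := by
        simp [expMonomial, PowerSeries.coeff_mk, Nat.div_self hm]
      simp only [h0, hc, toPowerSeries, PowerSeries.coeff_mk, hg.1, mul_one, one_mul]
    · simp [hm.ne']
    · rintro ⟨j, l⟩ hjl hne
      have := Finset.HasAntidiagonal.mem_antidiagonal.1 hjl
      dsimp only at this
      have hl : l ≠ 0 := by
        rintro rfl
        exact hne.1 (by simpa using this)
      have hj : j ≠ 0 := by
        rintro rfl
        exact hne.2 (by simpa using this)
      rw [hlow l (by omega) (by omega), mul_zero]
    · simp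
    · simp

theorem exists_groupLike_large {α β : V →ₗ[ℝ] ℝ} {a b : V} (haα : α a = 1) (haβ : β a = 0)
    (hb : β b = 1) {g : TensorSeries V} (hg : g ∈ groupLike V) (k : ℕ) (M : ℝ) :
    ∃ h ∈ groupLike V, (∀ i ≤ k, h i = g i) ∧ M < |lastFunctional α β (h (k + 1))| := by
  -- The functional is `1` on the iterated commutator, so this `c` makes the new coefficient exactly
  -- `|M| + 1`.
  set c : ℝ := |M| + 1 - lastFunctional α β (g (k + 1)) with hc
  obtain ⟨h, hh, hlow, htop⟩ := exists_groupLike_perturbation hg (Nat.succ_pos k)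
    (Submodule.smul_mem _ c (iteratedCommutator_mem a b k))
    ((isPrimitiveTensor_iteratedCommutator a b k).smul c)
  refine ⟨h, hh, fun i hi => hlow i (Nat.lt_succ_of_le hi), ?_⟩
  rw [htop, map_add, map_smul, lastFunctional_iteratedCommutator haα haβ hb, hc, smul_eq_mul,
    mul_one, add_sub_cancel]
  exact ((le_abs_self M).trans_lt (lt_add_one _)).trans_le (le_abs_self _)

theorem unitSeries_mem_groupLike : unitSeries V ∈ groupLike V := by
  refine ⟨rfl, fun n => ?_⟩
  have hz : ∀ j, j ≠ 0 → (unitSeries V j : TensorAlgebra ℝ V) = 0 := by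
    rintro (_ | j) hj
    · exact absurd rfl hj
    · rfl
  have h1 : (unitSeries V 0 : TensorAlgebra ℝ V) = 1 := rfl
  rcases Nat.eq_zero_or_pos n with rfl | hn
  · simp [h1, Algebra.TensorProduct.one_def]
  · rw [hz n hn.ne', map_zero, Finset.sum_eq_zero]
    intro ij hij
    have := Finset.HasAntidiagonal.mem_antidiagonal.1 hij
    rcases Nat.eq_zero_or_pos ij.1 with h | h
    · rw [hz ij.2 (by omega), TensorProduct.tmul_zero]
    · rw [hz ij.1 h.ne', TensorProduct.zero_tmul]

/-- There are group-like elements whose coefficients of the words `a ⋯ a b` grow arbitrarily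
fast. -/
theorem exists_groupLike_fast_growth {α β : V →ₗ[ℝ] ℝ} {a b : V} (haα : α a = 1) (haβ : β a = 0)
    (hb : β b = 1) (M : ℕ → ℝ) :
    ∃ g ∈ groupLike V, ∀ k, M k < |lastFunctional α β (g (k + 1))| := by
  choose next hnext hlow hbig using fun (g : groupLike V) (k : ℕ) =>
    exists_groupLike_large haα haβ hb g.2 k (M k)
  let H : ℕ → groupLike V := fun n =>
    Nat.rec ⟨unitSeries V, unitSeries_mem_groupLike⟩ (fun k g => ⟨next g k, hnext g k⟩) n
  have hstep : ∀ n i, i ≤ n → (H (n + 1)).1 i = (H n).1 i := fun n i hi => hlow (H n) n i hi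
  have hstable : ∀ n i, i ≤ n → (H n).1 i = (H i).1 i := by
    intro n i hi
    induction n, hi using Nat.le_induction with
    | base => rfl
    | succ n hi ih => rw [hstep n i hi, ih]
  -- The sequence `H` is stationary in each degree; in total degree `n` its limit inherits the
  -- group-like identity from `H n`.
  refine ⟨fun n => (H n).1 n, ⟨(H 0).2.1, fun n => ?_⟩, fun k => hbig (H k) k⟩
  rw [(H n).2.2 n]
  refine Finset.sum_congr rfl fun ij hij => ?_
  have := Finset.HasAntidiagonal.mem_antidiagonal.1 hij
  rw [hstable n ij.1 (by omega), hstable n ij.2 (by omega)]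

end Perturbation

/-! ### Meagreness of the growth bounds -/

section Meagre

variable {V : Type*} [AddCommGroup V] [Module ℝ V]

theorem continuous_functional_apply (ℓ : Module.Dual ℝ (TensorAlgebra ℝ V)) (n : ℕ) :
    Continuous fun g : groupLike V => ℓ ((g : TensorSeries V) n) := by
  have : IsModuleTopology ℝ (TPow V n) := ⟨rfl⟩
  have h : Continuous (ℓ ∘ₗ (TPow V n).subtype) := IsModuleTopology.continuous_of_linearMap _
  exact h.comp ((continuous_apply n).comp continuous_subtype_val)

/-- Any growth bound on the coefficients of the words `a ⋯ a b` defines a meagre set of group-like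
elements. -/
theorem isMeagre_growth_bound {α β : V →ₗ[ℝ] ℝ} {a b : V} (haα : α a = 1) (haβ : β a = 0)
    (hb : β b = 1) (C : ℕ → ℝ) :
    IsMeagre {g : groupLike V |
      ∀ k, |lastFunctional α β ((g : TensorSeries V) (k + 1))| ≤ C k} := by
  refine residual_of_dense_open (IsClosed.isOpen_compl (self := ?_)) ?_
  · simp only [ofPred_forall]
    exact isClosed_iInter fun k =>
      isClosed_le (continuous_functional_apply _ _).abs continuous_const
  · rw [dense_iff_inter_open]
    rintro U hU ⟨g, hgU⟩
    obtain ⟨O, hO, rfl⟩ := isOpen_induced_iff.1 hU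
    obtain ⟨I, u, hu, hbasic⟩ := isOpen_pi_iff.1 hO g hgU
    -- A basic open set constrains only the degrees in `I`; a perturbation in degree `I.sup id + 1`
    -- stays inside it and breaks the bound.
    obtain ⟨h, hh, hlow, hbig⟩ :=
      exists_groupLike_large haα haβ hb g.2 (I.sup id) (C (I.sup id))
    refine ⟨⟨h, hh⟩, hbasic fun i hi => ?_, fun hmem => absurd (hmem (I.sup id)) (not_le.2 hbig)⟩
    change h i ∈ u i
    rw [hlow i (Finset.le_sup (f := id) hi)]
    exact (hu i hi).2

end Meagre

theorem signatures_subset_groupLike {V : Type*} [NormedAddCommGroup V] [InnerProductSpace ℝ V]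
    {T : ℝ} (hT : 0 ≤ T) : signatures V T ⊆ groupLike V := by
  intro g hg
  simp only [signatures, mem_iUnion] at hg
  obtain ⟨p, -, X, -, S, hS, rfl⟩ := hg
  exact hS.mem_groupLike T ⟨hT, le_rfl⟩

end

end RoughPath

theorem mainTheorem10 {V : Type*} [NormedAddCommGroup V] [InnerProductSpace ℝ V]
    [FiniteDimensional ℝ V] (hV : 2 ≤ Module.finrank ℝ V) {T : ℝ} (hT : 0 < T) :
    RoughPath.signatures V T ⊂ RoughPath.groupLike V ∧
      IsMeagre {g : RoughPath.groupLike V | (g : RoughPath.TensorSeries V) ∈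
        RoughPath.signatures V T} := by
  let e := stdOrthonormalBasis ℝ V
  let i : Fin (Module.finrank ℝ V) := ⟨0, by omega⟩
  let j : Fin (Module.finrank ℝ V) := ⟨1, by omega⟩
  have hij : j ≠ i := by simp [i, j]
  have hnorm : ∀ l v, |innerₛₗ ℝ (e l) v| ≤ ‖v‖ := fun l v => by
    simpa using abs_real_inner_le_norm (e l) v
  have haα : innerₛₗ ℝ (e i) (e i) = 1 := by simp
  have haβ : innerₛₗ ℝ (e j) (e i) = 0 := by simpa using e.orthonormal.2 hij
  have hb : innerₛₗ ℝ (e j) (e j) = 1 := by simp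
  obtain ⟨C, hC⟩ := RoughPath.exists_growth_bounds (hnorm i) (hnorm j) hT.le
  refine ⟨⟨RoughPath.signatures_subset_groupLike hT.le, fun hsub => ?_⟩, ?_⟩
  · obtain ⟨g, hg, hbig⟩ := RoughPath.exists_groupLike_fast_growth haα haβ hb
      -- Diagonal bound: it dominates `C P w` at `k = max P w`, so exceeding it everywhere violates
      -- every bound in the list.
      (fun k => ∑ P ∈ Finset.range (k + 1), ∑ w ∈ Finset.range (k + 1), |C P w k|)
    obtain ⟨P, w, hPw⟩ := hC g (hsub hg)
    have h1 := (hbig (max P w)).trans_le (hPw (max P w))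
    have h2 : |C P w (max P w)| ≤ ∑ w' ∈ Finset.range (max P w + 1), |C P w' (max P w)| :=
      Finset.single_le_sum (f := fun w' => |C P w' (max P w)|) (fun _ _ => abs_nonneg _)
        (Finset.mem_range.2 (Nat.lt_succ_of_le (le_max_right P w)))
    have h3 := Finset.single_le_sum
      (f := fun P' => ∑ w' ∈ Finset.range (max P w + 1), |C P' w' (max P w)|)
      (fun _ _ => Finset.sum_nonneg fun _ _ => abs_nonneg _)
      (Finset.mem_range.2 (Nat.lt_succ_of_le (le_max_left P w)))
    exact absurd h1 (not_lt.2 ((le_abs_self _).trans (h2.trans h3)))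
  · refine IsMeagre.mono (fun g hg => ?_) (isMeagre_iUnion fun P : ℕ =>
      isMeagre_iUnion fun w : ℕ => RoughPath.isMeagre_growth_bound haα haβ hb (C P w))
    obtain ⟨P, w, hPw⟩ := hC g hg
    exact Set.mem_iUnion.2 ⟨P, Set.mem_iUnion.2 ⟨w, hPw⟩⟩
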